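/- Let $X,Y$ be separable real Hilbert spaces, $T>0$, $\Delta=\{(s,t)\in[0,T]^2: s<t\}$. Assume: (1) $\{U(t,s)\}_{0\le s\le t\le T}\subseteq\mathcal L(X)$ is a strongly continuous evolution operator ($(s,t)\mapsto U(t,s)x$ is continuous on $\overline\Delta$ for every $x\in X$, $U(t,t)=I$, $U(t,r)U(r,s)=U(t,s)$ for $s\le r\le t$); (2) $\{B(t)\}_{t\in[0,T]}\subseteq\mathcal L(Y;X)$ is bounded and $t\mapsto B(t)y$ is measurable for every $y\in Y$; (3) $f:[0,T]\to X$ is bounded and measurable; (4) for every $(s,t)\in\Delta$ the operator $Q(t,s)=\int_s^tU(t,r)B(r)B(r)^\star U(t,r)^\star\,dr$ (strong integral) has finite trace. Put $m^x(t,s)=U(t,s)x+\int_s^tU(t,r)f(r)\,dr$, let $\mathcal N_{0,Q(t,s)}$ be the centered Gaussian measure on $X$ with covariance $Q(t,s)$, and for $\varphi\in C_b(X)$ let $$P_{s,t}\varphi(x)=\int_X\varphi(y+m^x(t,s))\,\mathcal N_{0,Q(t,s)}(dy).$$ The Cameron–Martin space is $\mathcal H_{t,s}=Q(t,s)^{1/2}(X)$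 with norm $\|h\|_{\mathcal H_{t,s}}=\|Q(t,s)^{-1/2}h\|_X$, where $Q(t,s)^{-1/2}$ is the pseudo-inverse of $Q(t,s)^{1/2}$. For $h\in\mathcal H_{t,s}$ the white noise function $\widehat h$ is the sum in $L^2(X,\mathcal N_{0,Q(t,s)})$ of the series $\sum_{\lambda_k\ne0}\langle y,e_k\rangle\langle h,e_k\rangle\lambda_k^{-1}$, where $(e_k)$ is an orthonormal basis of $X$ with $Q(t,s)e_k=\lambda_ke_k$. Let $E$ be a normed space continuously embedded in $X$. A map $F:X\to G$ into a normed space is $E$-Fréchet differentiable at $x$, with differential $D_EF(x)\in\mathcal L(E;G)$, if $\|F(x+h)-F(x)-D_EF(x)h\|_G=o(\|h\|_E)$ as $\|h\|_E\to0$; higher differentials $D_E^kf:X\to\mathcal L^k(E)$ of $f:X\to\mathbb R$ ($\mathcal L^k(E)$ being the bounded $k$-linear forms on $E$) are defined by iteration, and $C^k_E(X)$ is the set of the $f\in C_b(X)$ that are $k$ times $E$-Fréchet differentiable at every point, with $D^j_Ef:X\to\mathcal L^j(E)$ continuous and bounded for all $j\le k$. Fix $(s,t)\in\Delta$ and suppose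 that $U(t,s)(E)\subseteq\mathcal H_{t,s}$ and $U(t,s)_{|E}\in\mathcal L(E,\mathcal H_{t,s})$. Put $\Lambda(t,s)=Q(t,s)^{-1/2}U(t,s)\in\mathcal L(E;X)$. Then the measure $\mathcal N_{0,Q(t,s)}$, the operator $Q(t,s)^{1/2}$ and the functions $\widehat{U(t,s)h}$, $h\in E$, exist, and for every $\varphi\in C_b(X)$: (i) $P_{s,t}\varphi\in\bigcap_{k\in\mathbb N}C^k_E(X)$. (ii) For all $x\in X$, $h\in E$, $$D_E(P_{s,t}\varphi)(x)(h)=\int_X\varphi(y+m^x(t,s))\,\widehat{U(t,s)h}(y)\,\mathcal N_{0,Q(t,s)}(dy).$$ (iii) For all $n\ge2$, $x\in X$ and $h_1,\dots,h_n\in E$, $$D^n_E(P_{s,t}\varphi)(x)(h_1,\dots,h_n)=\int_X\varphi(y+m^x(t,s))\,I_n(t,s)(y)(h_1,\dots,h_n)\,\mathcal N_{0,Q(t,s)}(dy),$$ where $$I_n(t,s)(y)(h_1,\dots,h_n)=\prod_{i=1}^n\widehat{U(t,s)h_i}(y)+\sum_{m=1}^{\lfloor n/2\rfloor}(-1)^m\sum\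 \prod_{k=1}^m\langle\Lambda(t,s)h_{i_{2k-1}},\Lambda(t,s)h_{i_{2k}}\rangle_X\prod_{\substack{1\le j\le n\\ j\ne i_1,\dots,i_{2m}}}\widehat{U(t,s)h_j}(y),$$ the inner sum being over all pairwise distinct $i_1,\dots,i_{2m}\in\{1,\dots,n\}$ with $i_{2k-1}<i_{2k}$ for $1\le k\le m$ and $i_{2k-1}<i_{2k+1}$ for $1\le k<m$. The integrands in (ii) and (iii) are integrable. (iv) There are constants $C_n>0$, depending only on $n$, such that for every $n\ge1$ $$\sup_{x\in X}\|D^n_E(P_{s,t}\varphi)(x)\|_{\mathcal L^n(E)}\le C_n\,\|\Lambda(t,s)\|^n_{\mathcal L(E;X)}\,\|\varphi\|_\infty .$$ -/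

import Mathlib

open MeasureTheory Filter Set
open scoped Topology BoundedContinuousFunction RealInnerProductSpace

noncomputable section

/-! ### Differentiability along a continuously embedded normed space

A normed space `E` continuously embedded in `X` is given with its embedding `ι : E →L[ℝ] X`,
an injective bounded linear operator. -/

section AlongE

variable {E X : Type*} [NormedAddCommGroup E] [NormedSpace ℝ E]
  [NormedAddCommGroup X] [NormedSpace ℝ X]
  {G : Type*} [NormedAddCommGroup G] [NormedSpace ℝ G]

/-- `F` is `E`-Fréchet differentiable at `x`: there is `T ∈ L(E, G)` with
`F (x + h) - F x - T h = o(‖h‖_E)` as `h → 0` in `E`. -/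
def DifferentiableAtAlong (ι : E →L[ℝ] X) (F : X → G) (x : X) : Prop :=
  DifferentiableAt ℝ (fun h : E => F (x + ι h)) 0

/-- The `E`-Fréchet differential `D_E F(x) ∈ L(E, G)`. -/
def derivAlong (ι : E →L[ℝ] X) (F : X → G) (x : X) : E →L[ℝ] G :=
  fderiv ℝ (fun h : E => F (x + ι h)) 0

/-- The iterated differentials `D_E^k f : X → L^k(E)`, where
`D_E^{k+1} f(x)(h_1, …, h_{k+1}) = (D_E (D_E^k f)(x) h_1)(h_2, …, h_{k+1})`. -/
def iterDerivAlong (ι : E →L[ℝ] X) (f : X → ℝ) :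
    (k : ℕ) → X → ContinuousMultilinearMap ℝ (fun _ : Fin k => E) ℝ
  | 0 => fun x => ContinuousMultilinearMap.uncurry0 ℝ E (f x)
  | k + 1 => fun x => (derivAlong ι (iterDerivAlong ι f k) x).uncurryLeft

/-- `f ∈ C_E^k(X)`: `f` is continuous and bounded, `k` times `E`-Fréchet differentiable at every
point, and `D_E^j f : X → L^j(E)` is continuous and bounded for `j ≤ k`. -/
structure IsCkAlong (ι : E →L[ℝ] X) (k : ℕ) (f : X → ℝ) : Prop where
  continuous : Continuous f
  bounded : ∃ K : ℝ, ∀ x, |f x| ≤ K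
  differentiable : ∀ j < k, ∀ x, DifferentiableAtAlong ι (iterDerivAlong ι f j) x
  continuous_deriv : ∀ j ≤ k, Continuous (iterDerivAlong ι f j)
  bounded_deriv : ∀ j ≤ k, ∃ K : ℝ, ∀ x, ‖iterDerivAlong ι f j x‖ ≤ K

end AlongE

/-! ### Operators -/

open Classical in
/-- A map which is linear and bounded, as a bounded linear operator. -/
def toBoundedOperator {V W : Type*} [NormedAddCommGroup V] [NormedSpace ℝ V]
    [NormedAddCommGroup W] [NormedSpace ℝ W] (g : V → W) : V →L[ℝ] W :=
  if hg : IsBoundedLinearMap ℝ g then hg.toContinuousLinearMap else 0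

section Hilbert

variable {X : Type*} [NormedAddCommGroup X] [InnerProductSpace ℝ X]

/-- A non-negative self-adjoint operator of finite trace: `∑ ⟪Q e_i, e_i⟫ < ∞` for some
orthonormal basis. -/
def HasFiniteTrace (Q : X →L[ℝ] X) : Prop :=
  ∃ (w : Set X) (e : HilbertBasis w ℝ X), Summable fun i => ⟪Q (e i), e i⟫

/-- `R` is the non-negative self-adjoint square root of `Q`. -/
def IsPositiveSqrt (Q R : X →L[ℝ] X) : Prop := R.IsPositive ∧ R ∘L R = Q

open Classical in
/-- The operator `Q^{1/2}`, for a non-negative self-adjoint operator `Q`. -/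
def opSqrt (Q : X →L[ℝ] X) : X →L[ℝ] X :=
  if hQ : ∃ R, IsPositiveSqrt Q R then hQ.choose else 0

open Classical in
/-- The pseudo-inverse `R^{-1}` of `R`, on the range of `R`: `R^{-1} y` is the unique element of
`(ker R)^⊥` that `R` maps to `y`. -/
def pseudoInverse (R : X →L[ℝ] X) (y : X) : X :=
  if hy : ∃ x ∈ (LinearMap.ker (R : X →ₗ[ℝ] X))ᗮ, R x = y then hy.choose else 0

/-! ### Gaussian measures -/

variable [MeasurableSpace X]

/-- `μ` is the Gaussian measure `N_{0,Q}`: its characteristic function is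
`u ↦ exp (-⟪Q u, u⟫ / 2)`. -/
def IsCenteredGaussian (Q : X →L[ℝ] X) (μ : Measure X) : Prop :=
  IsProbabilityMeasure μ ∧ ∀ u : X, charFun μ u = Complex.exp (-((⟪Q u, u⟫ / 2 : ℝ) : ℂ))

open Classical in
/-- The Gaussian measure `N_{0,Q}` on `X`, for `Q` non-negative, self-adjoint, of finite trace. -/
def centeredGaussian (Q : X →L[ℝ] X) : Measure X :=
  if hQ : ∃ μ : Measure X, IsCenteredGaussian Q μ then hQ.choose else 0

/-- `g` is (a version of) the white noise function `ĥ` of `N_{0,Q}`, for `h` in the Cameron–Martin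
space: for an orthonormal basis `(e_k)` of eigenvectors of `Q`, with `Q e_k = λ_k e_k`, the series
`∑_{λ_k ≠ 0} ⟪y, e_k⟫ ⟪h, e_k⟫ λ_k⁻¹` converges to `g(y)` in `L²(X, N_{0,Q})`.
(The terms with `λ_k = 0` vanish here, as `0⁻¹ = 0`.) -/
def IsWhiteNoise (Q : X →L[ℝ] X) (h : X) (g : X → ℝ) : Prop :=
  MemLp g 2 (centeredGaussian Q) ∧
  ∃ (w : Set X) (e : HilbertBasis w ℝ X) (eig : w → ℝ), (∀ k, Q (e k) = eig k • e k) ∧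
    Tendsto (fun S : Finset w =>
      eLpNorm (fun y => (∑ k ∈ S, ⟪y, e k⟫ * ⟪h, e k⟫ * (eig k)⁻¹) - g y) 2 (centeredGaussian Q))
      atTop (𝓝 0)

open Classical in
/-- The white noise function `ĥ` of the measure `N_{0,Q}`. -/
def whiteNoise (Q : X →L[ℝ] X) (h : X) : X → ℝ :=
  if hg : ∃ g, IsWhiteNoise Q h g then hg.choose else 0

end Hilbert

/-! ### The Ornstein–Uhlenbeck evolution operator -/

section OrnsteinUhlenbeck

variable {X Y : Type*} [NormedAddCommGroup X] [InnerProductSpace ℝ X] [CompleteSpace X]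
  [NormedAddCommGroup Y] [InnerProductSpace ℝ Y] [CompleteSpace Y]

/-- The vector `∫_s^t U(t,r) B(r) B(r)^* U(t,r)^* x dr`. -/
def covFun (U : ℝ → ℝ → X →L[ℝ] X) (B : ℝ → Y →L[ℝ] X) (t s : ℝ) (x : X) : X :=
  ∫ r in s..t, U t r (B r (ContinuousLinearMap.adjoint (B r) (ContinuousLinearMap.adjoint (U t r) x)))

/-- The covariance operator `Q(t,s) = ∫_s^t U(t,r) Q(r) U(t,r)^* dr`, with `Q(r) = B(r) B(r)^*`
(the integral is taken pointwise on the vectors of `X`). -/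
def covOp (U : ℝ → ℝ → X →L[ℝ] X) (B : ℝ → Y →L[ℝ] X) (t s : ℝ) : X →L[ℝ] X :=
  toBoundedOperator (covFun U B t s)

/-- The standing hypotheses on the evolution operator `U(t,s)`, `0 ≤ s ≤ t ≤ T`, on the diffusion
coefficients `B(t) ∈ L(Y, X)` and on the drift `f(t) ∈ X`, `0 ≤ t ≤ T`. -/
structure OUHypotheses (T : ℝ) (U : ℝ → ℝ → X →L[ℝ] X) (B : ℝ → Y →L[ℝ] X) (f : ℝ → X) :
    Prop where
  evol_continuous : ∀ x : X,
    ContinuousOn (fun p : ℝ × ℝ => U p.2 p.1 x) {p | 0 ≤ p.1 ∧ p.1 ≤ p.2 ∧ p.2 ≤ T}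
  evol_refl : ∀ t, 0 ≤ t → t ≤ T → U t t = ContinuousLinearMap.id ℝ X
  evol_comp : ∀ s r t, 0 ≤ s → s ≤ r → r ≤ t → t ≤ T → U t r ∘L U r s = U t s
  diff_bounded : ∃ K : ℝ, ∀ t ∈ Icc 0 T, ‖B t‖ ≤ K
  diff_measurable : ∀ y : Y, AEStronglyMeasurable (fun t => B t y) (volume.restrict (Icc 0 T))
  drift_bounded : ∃ K : ℝ, ∀ t ∈ Icc 0 T, ‖f t‖ ≤ K
  drift_measurable : AEStronglyMeasurable f (volume.restrict (Icc 0 T))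
  finite_trace : ∀ s t, 0 ≤ s → s < t → t ≤ T → HasFiniteTrace (covOp U B t s)

/-- `m^x(t,s) = U(t,s) x + ∫_s^t U(t,r) f(r) dr`. -/
def ouMean (U : ℝ → ℝ → X →L[ℝ] X) (f : ℝ → X) (t s : ℝ) (x : X) : X :=
  U t s x + ∫ r in s..t, U t r (f r)

/-- The Ornstein–Uhlenbeck evolution operator
`P_{s,t} φ(x) = ∫ φ(y + m^x(t,s)) N_{0,Q(t,s)}(dy)`. -/
def ouEvolution [MeasurableSpace X] (U : ℝ → ℝ → X →L[ℝ] X) (B : ℝ → Y →L[ℝ] X) (f : ℝ → X)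
    (s t : ℝ) (φ : X →ᵇ ℝ) (x : X) : ℝ :=
  ∫ y, φ (y + ouMean U f t s x) ∂(centeredGaussian (covOp U B t s))

variable {E : Type*} [NormedAddCommGroup E] [NormedSpace ℝ E]

/-- `V(E) ⊆ H := Q^{1/2}(X)` and `V|_E ∈ L(E, H)`, where `H` carries the norm
`‖h‖_H = ‖Q^{-1/2} h‖_X` of the Cameron–Martin space of `N_{0,Q}`. -/
def MapsToCameronMartin (ι : E →L[ℝ] X) (V Q : X →L[ℝ] X) : Prop :=
  (∀ h : E, V (ι h) ∈ range (opSqrt Q)) ∧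
  ∃ C : ℝ, ∀ h : E, ‖pseudoInverse (opSqrt Q) (V (ι h))‖ ≤ C * ‖h‖

/-- The operator `Λ(t,s) = Q(t,s)^{-1/2} U(t,s)` from `E` to `X`. -/
def ouLambda (ι : E →L[ℝ] X) (U : ℝ → ℝ → X →L[ℝ] X) (B : ℝ → Y →L[ℝ] X) (t s : ℝ) : E →L[ℝ] X :=
  toBoundedOperator fun h : E => pseudoInverse (opSqrt (covOp U B t s)) (U t s (ι h))

open Classical in
/-- The Hermite-type polynomials `I_n(t,s)(y)(h_1, …, h_n)`. The inner sum runs over the choices of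
`m` pairwise disjoint pairs of indices `(a_k, b_k)` with `a_k < b_k`, listed with `a_k`
increasing. -/
def hermiteI [MeasurableSpace X] (ι : E →L[ℝ] X) (U : ℝ → ℝ → X →L[ℝ] X) (B : ℝ → Y →L[ℝ] X)
    (t s : ℝ) (n : ℕ) (y : X) (h : Fin n → E) : ℝ :=
  (∏ i, whiteNoise (covOp U B t s) (U t s (ι (h i))) y) +
  ∑ m ∈ Finset.Icc 1 (n / 2), (-1 : ℝ) ^ m *
    ∑ p ∈ (Finset.univ : Finset ((Fin m → Fin n) × (Fin m → Fin n))).filter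
        (fun p => (∀ k, p.1 k < p.2 k) ∧ StrictMono p.1 ∧ Function.Injective p.2 ∧
          ∀ k l, p.1 k ≠ p.2 l),
      (∏ k, ⟪ouLambda ι U B t s (h (p.1 k)), ouLambda ι U B t s (h (p.2 k))⟫) *
      ∏ j ∈ Finset.univ.filter (fun j : Fin n => ∀ k, j ≠ p.1 k ∧ j ≠ p.2 k),
        whiteNoise (covOp U B t s) (U t s (ι (h j))) y

end OrnsteinUhlenbeck

section WellDefined

variable {V W : Type*} [NormedAddCommGroup V] [InnerProductSpace ℝ V]
  [NormedAddCommGroup W] [InnerProductSpace ℝ W]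

theorem countable_hilbertBasis [TopologicalSpace.SeparableSpace V] {κ : Type*}
    (e : HilbertBasis κ ℝ V) : Countable κ := by
  have key : (univ : Set κ).PairwiseDisjoint fun i => Metric.ball (e i) (1 / 2 : ℝ) := by
    intro i _ j _ hij
    apply Metric.ball_disjoint_ball
    have h1 : ‖e i - e j‖ ^ 2 = 2 := by
      rw [@norm_sub_sq_real, e.orthonormal.1 i, e.orthonormal.1 j, e.orthonormal.2 hij]
      norm_num
    rw [dist_eq_norm]
    nlinarith [norm_nonneg (e i - e j)]
  exact countable_univ_iff.1 (key.countable_of_isOpen (fun _ _ => Metric.isOpen_ball)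
    fun i _ => ⟨e i, Metric.mem_ball_self (by norm_num)⟩)

theorem aestronglyMeasurable_of_inner [CompleteSpace V] [TopologicalSpace.SeparableSpace V]
    {ν : Measure ℝ} {v : ℝ → V} (hv : ∀ z, AEStronglyMeasurable (fun r => ⟪z, v r⟫) ν) :
    AEStronglyMeasurable v ν := by
  obtain ⟨w, e, -⟩ := exists_hilbertBasis ℝ V
  have := countable_hilbertBasis e
  refine aestronglyMeasurable_of_tendsto_ae atTop (f := fun (S : Finset w) r =>
    ∑ k ∈ S, ⟪e k, v r⟫ • e k) (fun S => ?_) (Eventually.of_forall fun r => ?_)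
  · exact Finset.aestronglyMeasurable_fun_sum S fun k _ => (hv (e k)).smul_const (e k)
  · have := e.hasSum_repr (v r)
    simp only [e.repr_apply_apply] at this
    exact this

theorem aestronglyMeasurable_apply [CompleteSpace V] [TopologicalSpace.SeparableSpace V]
    {ν : Measure ℝ} {A : ℝ → V →L[ℝ] W} {v : ℝ → V}
    (hA : ∀ x, AEStronglyMeasurable (fun r => A r x) ν) (hv : AEStronglyMeasurable v ν) :
    AEStronglyMeasurable (fun r => A r (v r)) ν := by
  obtain ⟨w, e, -⟩ := exists_hilbertBasis ℝ V
  have := countable_hilbertBasis e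
  refine aestronglyMeasurable_of_tendsto_ae atTop (f := fun (S : Finset w) r =>
    ∑ k ∈ S, ⟪e k, v r⟫ • A r (e k)) (fun S => ?_) (Eventually.of_forall fun r => ?_)
  · exact Finset.aestronglyMeasurable_fun_sum S fun k _ =>
      (aestronglyMeasurable_const.inner hv).smul (hA (e k))
  · have := (A r).hasSum (e.hasSum_repr (v r))
    simp only [e.repr_apply_apply, map_smul] at this
    exact this

theorem aestronglyMeasurable_adjoint [CompleteSpace V] [CompleteSpace W]
    [TopologicalSpace.SeparableSpace V] {ν : Measure ℝ} {A : ℝ → V →L[ℝ] W}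
    (hA : ∀ x, AEStronglyMeasurable (fun r => A r x) ν) (z : W) :
    AEStronglyMeasurable (fun r => ContinuousLinearMap.adjoint (A r) z) ν := by
  refine aestronglyMeasurable_of_inner fun x => ?_
  simp only [ContinuousLinearMap.adjoint_inner_right]
  exact (hA x).inner aestronglyMeasurable_const

end WellDefined

section WellDefinedOU

variable {X Y : Type*} [NormedAddCommGroup X] [InnerProductSpace ℝ X] [CompleteSpace X]
  [NormedAddCommGroup Y] [InnerProductSpace ℝ Y] [CompleteSpace Y]

/-- Under the standing hypotheses, `x ↦ ∫_s^t U(t,r) B(r) B(r)^* U(t,r)^* x dr` is linear and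
bounded, so that `covOp` is this operator. -/
theorem isBoundedLinearMap_covFun [TopologicalSpace.SeparableSpace X]
    [TopologicalSpace.SeparableSpace Y] {T : ℝ} {U : ℝ → ℝ → X →L[ℝ] X} {B : ℝ → Y →L[ℝ] X} {f : ℝ → X}
    (H : OUHypotheses T U B f) {s t : ℝ} (hs : 0 ≤ s) (hst : s ≤ t) (ht : t ≤ T) :
    IsBoundedLinearMap ℝ (covFun U B t s) := by
  have hsub : Icc s t ⊆ Icc 0 T := Icc_subset_Icc hs ht
  have hUc : ∀ x, ContinuousOn (fun r => U t r x) (Icc s t) := fun x =>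
    (H.evol_continuous x).comp (f := fun r : ℝ => (r, t)) (by fun_prop)
      fun r hr => ⟨hs.trans hr.1, hr.2, ht⟩
  obtain ⟨N, hN⟩ : ∃ N, ∀ r : Icc s t, ‖U t r‖ ≤ N := by
    refine banach_steinhaus fun x => ?_
    obtain ⟨K, hK⟩ := isCompact_Icc.exists_bound_of_continuousOn (hUc x)
    exact ⟨K, fun r => hK r r.2⟩
  obtain ⟨K, hK⟩ := H.diff_bounded
  have hUm : ∀ x, AEStronglyMeasurable (fun r => U t r x) (volume.restrict (Icc s t)) :=
    fun x => (hUc x).aestronglyMeasurable measurableSet_Icc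
  have hBm : ∀ y, AEStronglyMeasurable (fun r => B r y) (volume.restrict (Icc s t)) :=
    fun y => (H.diff_measurable y).mono_measure (Measure.restrict_mono hsub le_rfl)
  set F : X → ℝ → X := fun x r => U t r (B r (ContinuousLinearMap.adjoint (B r)
    (ContinuousLinearMap.adjoint (U t r) x))) with hF
  have hm : ∀ x, AEStronglyMeasurable (F x) (volume.restrict (Icc s t)) := fun x =>
    aestronglyMeasurable_apply hUm (aestronglyMeasurable_apply hBm
      (aestronglyMeasurable_apply (fun z => aestronglyMeasurable_adjoint hBm z)
        (aestronglyMeasurable_adjoint hUm x)))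
  have hb : ∀ x, ∀ r ∈ Icc s t, ‖F x r‖ ≤ N * (K * (K * (N * ‖x‖))) := by
    intro x r hr
    have h1 : ‖U t r‖ ≤ N := hN ⟨r, hr⟩
    have h2 : ‖B r‖ ≤ K := hK r (hsub hr)
    have hN0 : 0 ≤ N := (norm_nonneg _).trans h1
    have hK0 : 0 ≤ K := (norm_nonneg _).trans h2
    refine ((U t r).le_of_opNorm_le h1 _).trans (mul_le_mul_of_nonneg_left ?_ hN0)
    refine ((B r).le_of_opNorm_le h2 _).trans (mul_le_mul_of_nonneg_left ?_ hK0)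
    refine ((ContinuousLinearMap.adjoint (B r)).le_of_opNorm_le (by simpa using h2) _).trans
      (mul_le_mul_of_nonneg_left ?_ hK0)
    exact (ContinuousLinearMap.adjoint (U t r)).le_of_opNorm_le (by simpa using h1) _
  have hi : ∀ x, IntervalIntegrable (F x) volume s t := fun x => by
    rw [intervalIntegrable_iff_integrableOn_Icc_of_le hst]
    exact Integrable.of_bound (hm x) _ ((ae_restrict_iff' measurableSet_Icc).2
      (Eventually.of_forall (hb x)))
  refine IsLinearMap.with_bound ⟨fun x y => ?_, fun c x => ?_⟩ (N * (K * (K * N)) * |t - s|)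
    fun x => ?_
  · simp only [covFun]
    rw [← intervalIntegral.integral_add (hi x) (hi y)]
    simp [hF]
  · simp only [covFun]
    rw [← intervalIntegral.integral_smul]
    simp
  · refine (intervalIntegral.norm_integral_le_of_norm_le_const (C := N * (K * (K * (N * ‖x‖))))
      fun r hr => hb x r ?_).trans (le_of_eq (by ring))
    rw [uIoc_of_le hst] at hr
    exact Ioc_subset_Icc_self hr

theorem pseudoInverse_spec (R : X →L[ℝ] X) {y : X} (hy : y ∈ range R) :
    pseudoInverse R y ∈ (LinearMap.ker (R : X →ₗ[ℝ] X))ᗮ ∧ R (pseudoInverse R y) = y := by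
  have hex : ∃ x ∈ (LinearMap.ker (R : X →ₗ[ℝ] X))ᗮ, R x = y := by
    obtain ⟨x, rfl⟩ := hy
    have : CompleteSpace (LinearMap.ker (R : X →ₗ[ℝ] X)) :=
      (R.isClosed_ker).completeSpace_coe
    refine ⟨x - (LinearMap.ker (R : X →ₗ[ℝ] X)).starProjection x,
      Submodule.sub_starProjection_mem_orthogonal x, ?_⟩
    have h0 : (LinearMap.ker (R : X →ₗ[ℝ] X)).starProjection x ∈ LinearMap.ker (R : X →ₗ[ℝ] X) :=
      Submodule.starProjection_apply_mem _ x
    rw [LinearMap.mem_ker] at h0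
    simpa using h0
  rw [pseudoInverse, dif_pos hex]
  exact hex.choose_spec

theorem pseudoInverse_eq (R : X →L[ℝ] X) {x : X}
    (hx : x ∈ (LinearMap.ker (R : X →ₗ[ℝ] X))ᗮ) : pseudoInverse R (R x) = x := by
  obtain ⟨h1, h2⟩ := pseudoInverse_spec R (mem_range_self x)
  have h3 : pseudoInverse R (R x) - x ∈ LinearMap.ker (R : X →ₗ[ℝ] X) := by
    rw [LinearMap.mem_ker]; simp [h2]
  have h4 := Submodule.inner_right_of_mem_orthogonal h3 (Submodule.sub_mem _ h1 hx)
  exact sub_eq_zero.1 (inner_self_eq_zero.1 h4)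

/-- If `V` maps `E` boundedly into the Cameron–Martin space, then `Q^{-1/2} V` is linear and
bounded from `E` to `X`, so that `ouLambda` is this operator. -/
theorem MapsToCameronMartin.isBoundedLinearMap {E : Type*} [NormedAddCommGroup E]
    [NormedSpace ℝ E] {ι : E →L[ℝ] X} {V Q : X →L[ℝ] X} (H : MapsToCameronMartin ι V Q) :
    IsBoundedLinearMap ℝ fun h : E => pseudoInverse (opSqrt Q) (V (ι h)) := by
  obtain ⟨hr, C, hC⟩ := H
  have key : ∀ (h : E) (x : X), x ∈ (LinearMap.ker (opSqrt Q : X →ₗ[ℝ] X))ᗮ →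
      opSqrt Q x = V (ι h) → pseudoInverse (opSqrt Q) (V (ι h)) = x := by
    intro h x hx hxe
    rw [← hxe, pseudoInverse_eq _ hx]
  refine IsLinearMap.with_bound ⟨fun x y => ?_, fun c x => ?_⟩ C hC
  · refine key _ _ (Submodule.add_mem _ (pseudoInverse_spec _ (hr x)).1
      (pseudoInverse_spec _ (hr y)).1) ?_
    simp [(pseudoInverse_spec _ (hr x)).2, (pseudoInverse_spec _ (hr y)).2]
  · refine key _ _ (Submodule.smul_mem _ c (pseudoInverse_spec _ (hr x)).1) ?_
    simp [(pseudoInverse_spec _ (hr x)).2]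

end WellDefinedOU

end

/-!
Write `μ = N_{0,Q}` with `Q = Q(t,s)`, `R = Q^{1/2}` and `Λ = R⁻¹ U(t,s)`. The proof rests on the
Cameron–Martin formula: for `z` orthogonal to `ker R`,
`∫ φ(y + R z) μ(dy) = ∫ φ(y) exp (g_z(y) - ‖z‖² / 2) μ(dy)`, where `g_z` is the white noise
function of `R z`. As `m^{x + h} = m^x + U(t,s) h = m^x + R Λ h`, moving the base point of
`P_{s,t} φ` by `h ∈ E` changes the density of the integral and leaves `φ(· + m^x)` alone
(`integral_comp_mean_add`), so that bounded continuity of `φ` suffices for smoothness.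

*Existence of the objects.* `Q` is non-negative and self-adjoint, and of finite trace, hence compact
and diagonal in a Hilbert basis with summable eigenvalues. The basis yields the square root, the
Gaussian measure (the law of the random series `∑ √λ_k ξ_k e_k`) and the convergence of the white
noise series. For the other assertions it is convenient to describe the white noise function of
`R z` without a basis, as the almost sure limit of functionals `⟪·, u_i⟫` with `R u_i → z`
(`IsGaussianLimit`). This determines it up to null sets, gives its Gaussian law, its linearity in
`z`, and the Cameron–Martin formula, which is verified on characteristic functions.

*Differentiation.* The family `W h = g_{Λ h}`, `h ∈ E`, is isonormal: linear up to null sets, with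
`W h` Gaussian of variance `‖Λ h‖²`. For `ψ ∈ L²(μ)` the moments `∫ ψ W(v_1) ⋯ W(v_n)` are
bounded multilinear forms by Hölder's inequality, and they are the differentials at `0` of
`h ↦ ∫ ψ exp (W h)`, which is therefore analytic at `0`. The factor `exp (-‖Λ h‖² / 2)` turns the
products of the `W(v_i)` into the polynomials of the recursion
`H_{n+2}(v) = W(v_0) H_{n+1}(v_1, …) - ∑_j ⟪Λ v_0, Λ v_j⟫ H_n(…)`
(`IsIsonormal.analytic_integral_mul_wickExp`), and a combinatorial argument on pairings of indices
identifies these with `I_n` (`hermitePoly_eq`).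

*Bounds and continuity.* The Cauchy–Schwarz and Hölder inequalities bound `∫ ψ I_n(h_1, …, h_n)`
by `C_n ‖ψ‖_{L²} ‖Λ‖ⁿ ∏ ‖h_i‖`. With `ψ = φ(· + m^x)` this is the estimate of the derivatives; with
`ψ = φ(· + m^x) - φ(· + m^{x'})` it gives their continuity in operator norm, by dominated
convergence.
-/

/-! ### Trace class operators: eigenbases and square roots -/

section Operators

variable {X : Type*} [NormedAddCommGroup X] [InnerProductSpace ℝ X]

theorem ContinuousLinearMap.IsPositive.norm_apply_sq_le {Q : X →L[ℝ] X} (hQ : Q.IsPositive)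
    (x : X) : ‖Q x‖ ^ 2 ≤ ‖Q‖ * ⟪Q x, x⟫ := by
  rcases eq_or_ne ‖Q‖ 0 with h0 | h0
  · have : Q = 0 := by simpa using h0
    simp [this]
  have hpos : 0 < ‖Q‖ := lt_of_le_of_ne (norm_nonneg _) (Ne.symm h0)
  -- The quadratic form of `Q` is non-negative at `x - ‖Q‖⁻¹ Q x`, a gradient step from `x`.
  have h1 := hQ.inner_nonneg_left (x - (‖Q‖)⁻¹ • Q x)
  have h2 : ⟪Q (Q x), Q x⟫ ≤ ‖Q‖ * ‖Q x‖ ^ 2 := by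
    calc ⟪Q (Q x), Q x⟫ ≤ ‖Q (Q x)‖ * ‖Q x‖ := real_inner_le_norm _ _
      _ ≤ (‖Q‖ * ‖Q x‖) * ‖Q x‖ := by gcongr; exact Q.le_opNorm _
      _ = _ := by ring
  have h3 : ⟪Q (Q x), x⟫ = ‖Q x‖ ^ 2 := by
    rw [hQ.inner_left_eq_inner_right, real_inner_self_eq_norm_sq]
  simp only [map_sub, map_smul, inner_sub_left, inner_sub_right, inner_smul_left,
    inner_smul_right, real_inner_self_eq_norm_sq, h3] at h1
  simp only [conj_trivial] at h1
  have h4 : ‖Q‖ * (‖Q‖⁻¹ * (‖Q‖⁻¹ * ⟪Q (Q x), Q x⟫)) ≤ ‖Q x‖ ^ 2 := by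
    rw [← mul_assoc, mul_inv_cancel₀ h0, one_mul, inv_mul_le_iff₀ hpos]; exact h2
  have h5 : ‖Q‖ * (‖Q‖⁻¹ * ‖Q x‖ ^ 2) = ‖Q x‖ ^ 2 := by
    rw [← mul_assoc, mul_inv_cancel₀ h0, one_mul]
  nlinarith [mul_nonneg hpos.le h1]

/-- A positive operator of finite trace is a norm limit of operators of finite rank, because
`∑ ‖Q e_i‖² ≤ ‖Q‖ ∑ ⟪Q e_i, e_i⟫` is finite. -/
theorem ContinuousLinearMap.IsPositive.isCompactOperator [CompleteSpace X] {Q : X →L[ℝ] X}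
    (hQ : Q.IsPositive) (htr : HasFiniteTrace Q) : IsCompactOperator Q := by
  classical
  obtain ⟨w, e, he⟩ := htr
  have hs : Summable fun i => ‖Q (e i)‖ ^ 2 :=
    Summable.of_nonneg_of_le (fun i => sq_nonneg _) (fun i => hQ.norm_apply_sq_le _)
      (he.mul_left ‖Q‖)
  set F : Finset w → X →L[ℝ] X := fun S => ∑ i ∈ S, (innerSL ℝ (e i)).smulRight (Q (e i)) with hF
  have hFc : ∀ S, IsCompactOperator (F S) := by
    intro S
    have h1 : IsCompactOperator (∑ i ∈ S,
        ((innerSL ℝ (e i)).smulRight (Q (e i)) : X →ₗ[ℝ] X)) := by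
      refine Finset.sum_induction _ (fun g : X → X => IsCompactOperator g)
        (fun _ _ ha hb => ha.add hb) isCompactOperator_zero fun i _ => ?_
      have h2 : IsCompactOperator (innerSL ℝ (e i)) :=
        isCompactOperator_of_locallyCompactSpace_dom _
      exact h2.clm_comp ((ContinuousLinearMap.id ℝ ℝ).smulRight (Q (e i)))
    convert h1 using 1
    ext x; simp [hF]
  refine isCompactOperator_of_tendsto (l := atTop) (F := F) ?_ (Eventually.of_forall hFc)
  rw [Metric.tendsto_atTop]
  intro ε hε
  obtain ⟨S, hS⟩ := summable_iff_vanishing_norm.1 hs ((ε / 2) ^ 2) (by positivity)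
  have key : ∀ S', S ≤ S' → ‖Q - F S'‖ ≤ ε / 2 := by
    intro S' hSS'
    refine ContinuousLinearMap.opNorm_le_bound _ (by positivity) fun x => ?_
    have h1 : Tendsto (fun V : Finset w => F V x) atTop (𝓝 (Q x)) := by
      have := Q.hasSum (e.hasSum_repr x)
      simp only [e.repr_apply_apply, map_smul] at this
      simpa [hF, HasSum] using this
    have h2 : Tendsto (fun V : Finset w => ‖F V x - F S' x‖) atTop (𝓝 ‖(Q - F S') x‖) :=
      (h1.sub_const _).norm
    refine le_of_tendsto h2 ((eventually_ge_atTop S').mono fun V hV => ?_)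
    have h3 : F V x - F S' x = ∑ i ∈ V \ S', ⟪e i, x⟫ • Q (e i) := by
      rw [sub_eq_iff_eq_add]
      simp [hF, Finset.sum_sdiff hV]
    rw [h3]
    have h4 : ∑ i ∈ V \ S', ‖Q (e i)‖ ^ 2 ≤ (ε / 2) ^ 2 := by
      refine (le_abs_self _).trans (hS (V \ S') ?_).le
      exact Finset.disjoint_left.2 fun a ha hb => (Finset.mem_sdiff.1 ha).2 (hSS' hb)
    have h5 : ∑ i ∈ V \ S', |⟪e i, x⟫| ^ 2 ≤ ‖x‖ ^ 2 := by
      simpa using e.orthonormal.sum_inner_products_le x (s := V \ S')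
    calc ‖∑ i ∈ V \ S', ⟪e i, x⟫ • Q (e i)‖
        ≤ ∑ i ∈ V \ S', |⟪e i, x⟫| * ‖Q (e i)‖ := by
          refine (norm_sum_le _ _).trans (le_of_eq ?_)
          simp [norm_smul]
      _ ≤ √(∑ i ∈ V \ S', |⟪e i, x⟫| ^ 2) * √(∑ i ∈ V \ S', ‖Q (e i)‖ ^ 2) :=
          Real.sum_mul_le_sqrt_mul_sqrt _ _ _
      _ ≤ √(‖x‖ ^ 2) * √((ε / 2) ^ 2) := by gcongr
      _ = ε / 2 * ‖x‖ := by
          rw [Real.sqrt_sq (norm_nonneg _), Real.sqrt_sq (by positivity), mul_comm]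
  refine ⟨S, fun S' hS' => ?_⟩
  rw [dist_comm, dist_eq_norm]
  linarith [key S' hS']

/-- The spectral theorem as a Hilbert basis: the union of Hilbert bases of the eigenspaces. -/
theorem IsCompactOperator.exists_hilbertBasis_eigenvectors [CompleteSpace X] {Q : X →L[ℝ] X}
    (hc : IsCompactOperator Q) (hQ : Q.IsSymmetric) :
    ∃ (w : Set X) (e : HilbertBasis w ℝ X) (eig : w → ℝ), ∀ k, Q (e k) = eig k • e k := by
  let V : ℝ → Submodule ℝ X := fun μ => Module.End.eigenspace (Q : Module.End ℝ X) μ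
  have hV : ∀ μ x, x ∈ V μ ↔ Q x = μ • x := fun μ x => Module.End.mem_eigenspace_iff
  have hcl : ∀ μ, IsClosed (V μ : Set X) := fun μ => by
    have : (V μ : Set X) = {x | Q x = μ • x} := by ext x; exact hV μ x
    rw [this]
    exact isClosed_eq Q.continuous (continuous_const_smul μ)
  have hcomp : ∀ μ, CompleteSpace (V μ) := fun μ => (hcl μ).completeSpace_coe
  choose W b hb using fun μ => exists_hilbertBasis ℝ (V μ)
  let w : Set X := {x | ∃ μ, ∃ hx : x ∈ V μ, (⟨x, hx⟩ : V μ) ∈ W μ}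
  have hon : Orthonormal ℝ ((↑) : w → X) := by
    constructor
    · rintro ⟨x, μ, hx, hw⟩
      have := (b μ).orthonormal.1 ⟨_, hw⟩
      rw [hb μ] at this
      simpa using this
    · rintro ⟨x, μ, hx, hw⟩ ⟨y, ν, hy, hw'⟩ hne
      have hxy : x ≠ y := fun h => hne (Subtype.ext h)
      by_cases hμ : μ = ν
      · subst hμ
        have := (b μ).orthonormal.2 (i := ⟨_, hw⟩) (j := ⟨_, hw'⟩)
          (fun h => hxy (by simpa using h))
        rw [hb μ] at this
        simpa using this
      · have h1 : ⟪Q x, y⟫ = ⟪x, Q y⟫ := hQ x y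
        rw [(hV μ x).1 hx, (hV ν y).1 hy, inner_smul_left, inner_smul_right] at h1
        exact (mul_eq_mul_right_iff.1 h1).resolve_left hμ
  have hspan : (Submodule.span ℝ (range ((↑) : w → X)))ᗮ = ⊥ := by
    rw [← le_bot_iff, ← ContinuousLinearMap.orthogonalComplement_iSup_eigenspaces_eq_bot hc hQ]
    intro z hz
    rw [Submodule.mem_orthogonal] at hz
    rw [← Submodule.iInf_orthogonal, Submodule.mem_iInf]
    intro μ
    rw [Submodule.mem_orthogonal]
    intro x hx
    have h1 := ((V μ).subtypeL).hasSum ((b μ).hasSum_repr ⟨x, hx⟩)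
    have h2 : HasSum (fun i => ⟪(V μ).subtypeL ((b μ).repr ⟨x, hx⟩ i • b μ i), z⟫) ⟪x, z⟫ :=
      h1.mapL (innerSL ℝ z |>.comp (ContinuousLinearMap.id ℝ X)) |> fun h => by
        simpa [real_inner_comm z, inner_smul_right] using h
    have h3 : ∀ i, ⟪(V μ).subtypeL ((b μ).repr ⟨x, hx⟩ i • b μ i), z⟫ = 0 := by
      intro i
      have h4 : ⟪((i : V μ) : X), z⟫ = 0 :=
        hz _ (Submodule.subset_span ⟨⟨_, μ, (i : V μ).2, i.2⟩, rfl⟩)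
      rw [hb μ]
      simp [inner_smul_left, h4]
    simp only [h3] at h2
    exact h2.unique hasSum_zero
  refine ⟨w, HilbertBasis.mkOfOrthogonalEqBot hon hspan, fun k => k.2.choose, fun k => ?_⟩
  rw [HilbertBasis.coe_mkOfOrthogonalEqBot]
  exact (hV _ _).1 k.2.choose_spec.choose

theorem HilbertBasis.eq_of_inner_eq {κ : Type*} (e : HilbertBasis κ ℝ X) {x y : X}
    (h : ∀ k, ⟪e k, x⟫ = ⟪e k, y⟫) : x = y := by
  apply e.repr.injective
  ext k
  simpa [e.repr_apply_apply] using h k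

/-- The operator which is diagonal in a Hilbert basis, with a given bounded diagonal. -/
theorem HilbertBasis.exists_diagonal [CompleteSpace X] {κ : Type*} (e : HilbertBasis κ ℝ X)
    (a : κ → ℝ) {M : ℝ} (ha : ∀ k, |a k| ≤ M) :
    ∃ D : X →L[ℝ] X, ∀ x k, ⟪e k, D x⟫ = a k * ⟪e k, x⟫ := by
  have hsq : ∀ x : X, Summable fun k => ‖a k * ⟪e k, x⟫‖ ^ 2 := fun x => by
    refine Summable.of_nonneg_of_le (fun k => sq_nonneg _) (fun k => ?_)
      ((e.summable_inner_mul_inner x x).mul_left (M ^ 2))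
    rw [norm_mul, mul_pow, real_inner_comm, ← sq, Real.norm_eq_abs, Real.norm_eq_abs, sq_abs ⟪_, _⟫]
    gcongr
    exact ha k
  have hsum : ∀ x : X, Summable fun k => (a k * ⟪e k, x⟫) • e k := fun x => by
    have := (e.orthonormal.orthogonalFamily.summable_iff_norm_sq_summable
      fun k => a k * ⟪e k, x⟫).2 (hsq x)
    simpa using this
  have hin : ∀ x k, ⟪e k, ∑' j, (a j * ⟪e j, x⟫) • e j⟫ = a k * ⟪e k, x⟫ := fun x k => by
    classical
    have h1 := (hsum x).hasSum.mapL (innerSL ℝ (e k))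
    have h2 : ∀ j, innerSL ℝ (e k) ((a j * ⟪e j, x⟫) • e j) =
        if j = k then a k * ⟪e k, x⟫ else 0 := by
      intro j
      rw [innerSL_apply_apply, inner_smul_right, orthonormal_iff_ite.1 e.orthonormal]
      by_cases h : k = j
      · subst h; simp
      · simp [h, Ne.symm h]
    simp only [h2] at h1
    exact h1.unique (hasSum_ite_eq k _)
  let D : X →ₗ[ℝ] X :=
    { toFun := fun x => ∑' j, (a j * ⟪e j, x⟫) • e j
      map_add' := fun x y => e.eq_of_inner_eq fun k => by
        rw [inner_add_right, hin, hin, hin, inner_add_right]; ring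
      map_smul' := fun c x => e.eq_of_inner_eq fun k => by
        rw [inner_smul_right, hin, hin, inner_smul_right, RingHom.id_apply]; ring }
  refine ⟨D.mkContinuous |M| fun x => ?_, fun x k => hin x k⟩
  have h1 : ‖D x‖ ^ 2 ≤ (|M| * ‖x‖) ^ 2 := by
    have h2 := e.hasSum_inner_mul_inner (D x) (D x)
    have h3 := (e.hasSum_inner_mul_inner x x).mul_left (M ^ 2)
    rw [real_inner_self_eq_norm_sq] at h2 h3
    rw [mul_pow, sq_abs]
    refine hasSum_le (fun k => ?_) h2 h3
    rw [real_inner_comm, ← sq, real_inner_comm (e k) x, ← sq,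
      show ⟪e k, D x⟫ = _ from hin x k, mul_pow]
    have := pow_le_pow_left₀ (abs_nonneg _) (ha k) 2
    rw [sq_abs] at this
    gcongr
  exact le_of_sq_le_sq h1 (by positivity)

theorem IsPositiveSqrt.norm_apply_sq {Q R : X →L[ℝ] X} (h : IsPositiveSqrt Q R) (x : X) :
    ‖R x‖ ^ 2 = ⟪Q x, x⟫ := by
  rw [← h.2, ContinuousLinearMap.comp_apply, h.1.inner_left_eq_inner_right,
    real_inner_self_eq_norm_sq]

theorem IsPositiveSqrt.apply_of_eigenvector {Q R : X →L[ℝ] X} (h : IsPositiveSqrt Q R) {x : X}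
    {c : ℝ} (hc : 0 ≤ c) (hx : Q x = c • x) : R x = √c • x := by
  rcases hc.eq_or_lt with rfl | hc
  · have := h.norm_apply_sq x
    simp [hx] at this
    simp [this]
  -- `y = R x - √c x` satisfies `R y = -√c y`, so that positivity of `R` forces `y = 0`.
  have h1 : R (R x) = c • x := by rw [← hx, ← h.2]; rfl
  have h2 : R (R x - √c • x) = -√c • (R x - √c • x) := by
    rw [map_sub, map_smul, h1, smul_sub, smul_smul, neg_mul, Real.mul_self_sqrt hc.le]
    module
  have h3 := h.1.inner_nonneg_left (R x - √c • x)
  rw [h2, inner_smul_left, real_inner_self_eq_norm_sq] at h3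
  simp only [conj_trivial, neg_mul, Left.nonneg_neg_iff] at h3
  have h4 : ‖R x - √c • x‖ ^ 2 = 0 :=
    le_antisymm (nonpos_of_mul_nonpos_right h3 (Real.sqrt_pos.2 hc)) (sq_nonneg _)
  exact sub_eq_zero.1 (by simpa using h4)

/-- Square roots of the eigenvalues turn the truncated white noise series of `R z` into the
expansion of `z` in the eigenbasis: the eigenvectors with eigenvalue `0` are orthogonal to `z`. -/
theorem IsPositiveSqrt.tendsto_apply_sum {Q R : X →L[ℝ] X} {z : X} (hR : IsPositiveSqrt Q R)
    (hQ : Q.IsPositive) {κ : Type*} (e : HilbertBasis κ ℝ X) {eig : κ → ℝ}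
    (he : ∀ k, Q (e k) = eig k • e k) (hz : z ∈ (LinearMap.ker (R : X →ₗ[ℝ] X))ᗮ) :
    Tendsto (fun S : Finset κ => R (∑ k ∈ S, (⟪R z, e k⟫ * (eig k)⁻¹) • e k)) atTop (𝓝 z) := by
  have h0 : ∀ k, 0 ≤ eig k := fun k => by
    have h1 := hQ.inner_nonneg_left (e k)
    rw [he, inner_smul_left, real_inner_self_eq_norm_sq, e.orthonormal.1] at h1
    simpa using h1
  have h1 : HasSum (fun k => ⟪e k, z⟫ • e k) z := by
    simpa only [e.repr_apply_apply] using e.hasSum_repr z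
  refine Tendsto.congr (fun S => ?_) h1
  rw [map_sum]
  refine Finset.sum_congr rfl fun k _ => ?_
  have h2 := hR.apply_of_eigenvector (h0 k) (he k)
  change ⟪e k, z⟫ • e k = _
  rw [map_smul, hR.1.inner_left_eq_inner_right, h2, inner_smul_right, smul_smul]
  congr 1
  rcases (h0 k).eq_or_lt with h | h
  · have h3 : e k ∈ LinearMap.ker (R : X →ₗ[ℝ] X) := by
      rw [LinearMap.mem_ker]; simpa [← h] using h2
    rw [Submodule.inner_right_of_mem_orthogonal h3 hz, ← h]
    simp
  · have h4 : √(eig k) * √(eig k) = eig k := Real.mul_self_sqrt h.le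
    rw [real_inner_comm (e k) z]
    calc ⟪e k, z⟫ = ⟪e k, z⟫ * (eig k * (eig k)⁻¹) := by rw [mul_inv_cancel₀ h.ne', mul_one]
      _ = ⟪e k, z⟫ * (√(eig k) * √(eig k) * (eig k)⁻¹) := by rw [h4]
      _ = _ := by ring

theorem exists_isPositiveSqrt [CompleteSpace X] {Q : X →L[ℝ] X} (hQ : Q.IsPositive)
    {κ : Type*} (e : HilbertBasis κ ℝ X) {eig : κ → ℝ} (he : ∀ k, Q (e k) = eig k • e k) :
    ∃ R, IsPositiveSqrt Q R := by
  have hin : ∀ k, ⟪Q (e k), e k⟫ = eig k := fun k => by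
    rw [he, inner_smul_left, real_inner_self_eq_norm_sq, e.orthonormal.1]; simp
  have h0 : ∀ k, 0 ≤ eig k := fun k => by rw [← hin]; exact hQ.inner_nonneg_left _
  have hle : ∀ k, eig k ≤ ‖Q‖ := fun k => by
    rw [← hin]
    refine (real_inner_le_norm _ _).trans ?_
    have := Q.le_opNorm (e k)
    simpa [e.orthonormal.1 k] using this
  obtain ⟨R, hR⟩ := e.exists_diagonal (fun k => √(eig k)) (M := √‖Q‖) fun k => by
    rw [abs_of_nonneg (Real.sqrt_nonneg _)]
    exact Real.sqrt_le_sqrt (hle k)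
  refine ⟨R, (ContinuousLinearMap.isPositive_iff _).2 ⟨fun x y => ?_, fun x => ?_⟩, ?_⟩
  · have h1 := e.hasSum_inner_mul_inner (R x) y
    have h2 := e.hasSum_inner_mul_inner x (R y)
    refine h1.unique (h2.congr_fun fun k => ?_)
    rw [hR, real_inner_comm, hR, real_inner_comm x]; ring
  · refine (e.hasSum_inner_mul_inner (R x) x).nonneg fun k => ?_
    rw [real_inner_comm, hR, mul_assoc]
    exact mul_nonneg (Real.sqrt_nonneg _) (mul_self_nonneg _)
  · ext x
    refine e.eq_of_inner_eq fun k => ?_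
    rw [ContinuousLinearMap.comp_apply, hR, hR, ← mul_assoc, Real.mul_self_sqrt (h0 k),
      ← hQ.inner_left_eq_inner_right, he, inner_smul_left]
    simp

/-- The Hilbert–Schmidt norm of a symmetric operator does not depend on the basis. -/
theorem summable_norm_sq_of_hilbertBasis {R : X →L[ℝ] X} (hR : R.IsSymmetric) {κ κ' : Type*}
    (e : HilbertBasis κ ℝ X) (e' : HilbertBasis κ' ℝ X) (h : Summable fun i => ‖R (e i)‖ ^ 2) :
    Summable fun k => ‖R (e' k)‖ ^ 2 := by
  have h1 : ∀ x, HasSum (fun k => ⟪e' k, x⟫ ^ 2) (‖x‖ ^ 2) := fun x => by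
    have := e'.hasSum_inner_mul_inner x x
    rw [real_inner_self_eq_norm_sq] at this
    exact this.congr_fun fun k => by rw [real_inner_comm, sq]
  have h2 : ∀ x, HasSum (fun k => ⟪e k, x⟫ ^ 2) (‖x‖ ^ 2) := fun x => by
    have := e.hasSum_inner_mul_inner x x
    rw [real_inner_self_eq_norm_sq] at this
    exact this.congr_fun fun k => by rw [real_inner_comm, sq]
  have h3 : Summable fun p : κ × κ' => ⟪e' p.2, R (e p.1)⟫ ^ 2 := by
    rw [summable_prod_of_nonneg (fun p => sq_nonneg _)]
    refine ⟨fun i => (h1 (R (e i))).summable, h.congr fun i => ?_⟩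
    exact (h1 (R (e i))).tsum_eq.symm
  have h3' : Summable fun p : κ' × κ => ⟪e' p.1, R (e p.2)⟫ ^ 2 := h3.prod_symm
  have h4 : Summable fun k => ∑' i, ⟪e' k, R (e i)⟫ ^ 2 := by
    rw [summable_prod_of_nonneg (fun p => sq_nonneg _)] at h3'
    exact h3'.2
  refine h4.congr fun k => ?_
  rw [← (h2 (R (e' k))).tsum_eq]
  refine tsum_congr fun i => ?_
  rw [show ⟪e' k, R (e i)⟫ = ⟪R (e' k), e i⟫ from (hR _ _).symm, real_inner_comm]

end Operators

/-! ### Existence of the Gaussian measure with a given covariance -/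

section GaussianExistence

open ProbabilityTheory

variable {X : Type*} [NormedAddCommGroup X] [InnerProductSpace ℝ X] [CompleteSpace X]

variable {κ : Type*}

/-- The characteristic function, at `1`, of a linear combination of independent standard Gaussian
variables. -/
theorem charFun_map_sum_infinitePi_gaussianReal (c : κ → ℝ) (S : Finset κ) :
    ∫ ω, Complex.exp (((∑ k ∈ S, c k * ω k : ℝ) : ℂ) * Complex.I)
      ∂(Measure.infinitePi fun _ : κ => gaussianReal 0 1) =
    Complex.exp (-((∑ k ∈ S, c k ^ 2) / 2 : ℝ)) := by
  set P := Measure.infinitePi fun _ : κ => gaussianReal 0 1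
  have hind : iIndepFun (fun (k : κ) (ω : κ → ℝ) => c k * ω k) P :=
    iIndepFun_infinitePi (P := fun _ => gaussianReal 0 1) (X := fun k x => c k * x)
      (fun k => by fun_prop)
  have h1 := iIndepFun.charFun_map_fun_finsetSum_eq_prod (s := S)
    (X := fun (k : κ) (ω : κ → ℝ) => c k * ω k) (P := P)
    (fun k _ => Measurable.aemeasurable (by fun_prop)) (hind.restrict S)
  have h2 := congrFun h1 1
  rw [charFun_apply_real, integral_map (Measurable.aemeasurable (by fun_prop))
    (by fun_prop)] at h2
  simp only [Complex.ofReal_one, one_mul] at h2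
  rw [h2, Finset.prod_apply]
  have h3 : ∀ k, P.map (fun ω : κ → ℝ => c k * ω k) = gaussianReal 0 (c k ^ 2).toNNReal := by
    intro k
    have : P.map (fun ω : κ → ℝ => ω k) = gaussianReal 0 1 := Measure.infinitePi_map_eval _ k
    rw [show (fun ω : κ → ℝ => c k * ω k) = (fun x => c k * x) ∘ fun ω => ω k from rfl,
      ← Measure.map_map (by fun_prop) (by fun_prop), this, gaussianReal_map_const_mul,
      mul_zero, mul_one, Real.toNNReal_of_nonneg (sq_nonneg _)]
  simp only [h3, charFun_gaussianReal]
  rw [← Complex.exp_sum]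
  congr 1
  push_cast
  rw [Finset.sum_div, ← Finset.sum_neg_distrib]
  refine Finset.sum_congr rfl fun k _ => ?_
  rw [Real.coe_toNNReal _ (sq_nonneg _)]
  push_cast
  ring

/-- The Gaussian measure is the law of the almost surely convergent series `∑ √λ_k ξ_k e_k`, with
independent standard Gaussian coefficients `ξ_k`. -/
theorem exists_isCenteredGaussian [MeasurableSpace X] [BorelSpace X] [SecondCountableTopology X]
    [Countable κ] {Q : X →L[ℝ] X} (hQ : Q.IsPositive) (e : HilbertBasis κ ℝ X) {eig : κ → ℝ}
    (he : ∀ k, Q (e k) = eig k • e k) (hs : Summable eig) :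
    ∃ μ : Measure X, IsCenteredGaussian Q μ := by
  have hin : ∀ k, ⟪Q (e k), e k⟫ = eig k := fun k => by
    rw [he, inner_smul_left, real_inner_self_eq_norm_sq, e.orthonormal.1]; simp
  have h0 : ∀ k, 0 ≤ eig k := fun k => by rw [← hin]; exact hQ.inner_nonneg_left _
  set P := Measure.infinitePi fun _ : κ => gaussianReal 0 1 with hP
  have hlaw : ∀ k, P.map (fun ω : κ → ℝ => ω k) = gaussianReal 0 1 :=
    fun k => Measure.infinitePi_map_eval _ k
  have hsq : ∀ k, ∫⁻ ω, ENNReal.ofReal (ω k ^ 2) ∂P = 1 := by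
    intro k
    have h1 : ∫⁻ x, ENNReal.ofReal (x ^ 2) ∂(gaussianReal 0 1) = 1 := by
      have h2 : Integrable (fun x : ℝ => x ^ 2) (gaussianReal 0 1) :=
        (memLp_id_gaussianReal 2).integrable_sq
      rw [← ofReal_integral_eq_lintegral_ofReal h2 (Eventually.of_forall fun x => sq_nonneg _)]
      have h3 := variance_id_gaussianReal (μ := 0) (v := 1)
      rw [variance_eq_integral (by fun_prop)] at h3
      simp at h3
      simp [h3]
    rw [← h1, ← hlaw k, lintegral_map (by fun_prop) (by fun_prop)]
  have hae : ∀ᵐ ω ∂P, Summable fun k => (√(eig k) * ω k) • e k := by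
    have h1 : ∫⁻ ω, ∑' k, ENNReal.ofReal (eig k) * ENNReal.ofReal (ω k ^ 2) ∂P ≠ ⊤ := by
      rw [lintegral_tsum (fun k => Measurable.aemeasurable (by fun_prop))]
      have : ∀ k, ∫⁻ ω, ENNReal.ofReal (eig k) * ENNReal.ofReal (ω k ^ 2) ∂P =
          ENNReal.ofReal (eig k) := fun k => by
        rw [lintegral_const_mul _ (by fun_prop), hsq, mul_one]
      simp only [this]
      exact hs.tsum_ofReal_ne_top
    filter_upwards [ae_lt_top (by fun_prop) h1] with ω hω
    have h2 : Summable fun k => eig k * ω k ^ 2 := by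
      have h3 := ENNReal.summable_toReal hω.ne
      refine h3.congr fun k => ?_
      rw [ENNReal.toReal_mul, ENNReal.toReal_ofReal (h0 k), ENNReal.toReal_ofReal (sq_nonneg _)]
    have h4 := (e.orthonormal.orthogonalFamily.summable_iff_norm_sq_summable
      fun k => √(eig k) * ω k).2 (h2.congr fun k => by
        rw [Real.norm_eq_abs, sq_abs, mul_pow, Real.sq_sqrt (h0 k)])
    simpa using h4
  set Ψ : (κ → ℝ) → X := fun ω => ∑' k, (√(eig k) * ω k) • e k with hΨ
  have hlim : ∀ᵐ ω ∂P, Tendsto (fun S : Finset κ => ∑ k ∈ S, (√(eig k) * ω k) • e k) atTop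
      (𝓝 (Ψ ω)) := hae.mono fun ω h => h.hasSum
  have hΨm : AEMeasurable Ψ P :=
    aemeasurable_of_tendsto_metrizable_ae atTop
      (fun S => Measurable.aemeasurable (by fun_prop)) hlim
  refine ⟨P.map Ψ, Measure.isProbabilityMeasure_map hΨm, fun u => ?_⟩
  rw [charFun_apply, integral_map hΨm (by fun_prop)]
  have h1 : Tendsto (fun S : Finset κ => ∫ ω, Complex.exp
      (((∑ k ∈ S, (√(eig k) * ⟪e k, u⟫) * ω k : ℝ) : ℂ) * Complex.I) ∂P) atTop
      (𝓝 (∫ ω, Complex.exp ((⟪Ψ ω, u⟫ : ℝ) * Complex.I) ∂P)) := by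
    refine tendsto_integral_filter_of_dominated_convergence (fun _ => 1)
      (Eventually.of_forall fun S => Measurable.aestronglyMeasurable (by fun_prop))
      (Eventually.of_forall fun S => Eventually.of_forall fun ω => ?_) (integrable_const 1) ?_
    · rw [Complex.norm_exp_ofReal_mul_I]
    · filter_upwards [hlim] with ω hω
      have h2 : Tendsto (fun S : Finset κ => (∑ k ∈ S, (√(eig k) * ⟪e k, u⟫) * ω k : ℝ)) atTop
          (𝓝 ⟪Ψ ω, u⟫) := by
        refine (hω.inner (tendsto_const_nhds (x := u))).congr fun S => ?_
        rw [sum_inner]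
        exact Finset.sum_congr rfl fun k _ => by
          rw [inner_smul_left]; simp only [conj_trivial]; ring
      exact (Complex.continuous_exp.tendsto _).comp
        (((Complex.continuous_ofReal.tendsto _).comp h2).mul_const _)
  refine tendsto_nhds_unique h1 ?_
  simp only [charFun_map_sum_infinitePi_gaussianReal (fun k => √(eig k) * ⟪e k, u⟫), hP]
  have h3 : Tendsto (fun S : Finset κ => ∑ k ∈ S, (√(eig k) * ⟪e k, u⟫) ^ 2) atTop
      (𝓝 ⟪Q u, u⟫) := by
    have h4 := e.hasSum_inner_mul_inner (Q u) u
    refine h4.congr_fun fun k => ?_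
    rw [mul_pow, Real.sq_sqrt (h0 k), hQ.inner_left_eq_inner_right, he, inner_smul_right,
      real_inner_comm u]
    ring
  exact (Complex.continuous_exp.tendsto _).comp
    ((Complex.continuous_ofReal.tendsto _).comp (h3.div_const 2)).neg

end GaussianExistence

/-! ### Gaussian functionals and the Cameron–Martin formula -/

section WhiteNoise

open ProbabilityTheory

variable {X : Type*} [NormedAddCommGroup X] [InnerProductSpace ℝ X] [MeasurableSpace X]

/-- `g` is an almost sure limit of continuous linear functionals `⟪·, u_n⟫` for which `R u_n → z`.
With `R = Q^{1/2}`, this says that `g` is a version of the Gaussian functional of `N_{0,Q}` attached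
to `z`, that is of the white noise function of `R z`. -/
def IsGaussianLimit (R : X →L[ℝ] X) (μ : Measure X) (z : X) (g : X → ℝ) : Prop :=
  ∃ u : ℕ → X, Tendsto (fun n => R (u n)) atTop (𝓝 z) ∧
    ∀ᵐ y ∂μ, Tendsto (fun n => ⟪y, u n⟫) atTop (𝓝 (g y))

variable {R Q : X →L[ℝ] X} {μ : Measure X} {z z' : X} {g g' : X → ℝ}

theorem isGaussianLimit_inner (R : X →L[ℝ] X) (μ : Measure X) (v : X) :
    IsGaussianLimit R μ (R v) fun y => ⟪y, v⟫ :=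
  ⟨fun _ => v, tendsto_const_nhds, Eventually.of_forall fun _ => tendsto_const_nhds⟩

theorem IsGaussianLimit.add (h : IsGaussianLimit R μ z g) (h' : IsGaussianLimit R μ z' g') :
    IsGaussianLimit R μ (z + z') fun y => g y + g' y := by
  obtain ⟨u, hu, hg⟩ := h
  obtain ⟨u', hu', hg'⟩ := h'
  refine ⟨fun n => u n + u' n, by simpa using hu.add hu', ?_⟩
  filter_upwards [hg, hg'] with y hy hy'
  simpa [inner_add_right] using hy.add hy'

theorem IsGaussianLimit.const_mul (c : ℝ) (h : IsGaussianLimit R μ z g) :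
    IsGaussianLimit R μ (c • z) fun y => c * g y := by
  obtain ⟨u, hu, hg⟩ := h
  refine ⟨fun n => c • u n, by simpa using hu.const_smul c, ?_⟩
  filter_upwards [hg] with y hy
  simpa [inner_smul_right] using hy.const_mul c

variable [BorelSpace X] [SecondCountableTopology X]

theorem IsGaussianLimit.aemeasurable (h : IsGaussianLimit R μ z g) : AEMeasurable g μ := by
  obtain ⟨u, -, hg⟩ := h
  exact aemeasurable_of_tendsto_metrizable_ae atTop (fun n => by fun_prop) hg

theorem IsGaussianLimit.integral_cexp (hR : IsPositiveSqrt Q R) (hμ : IsCenteredGaussian Q μ)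
    (h : IsGaussianLimit R μ z g) :
    ∫ y, Complex.exp (g y * Complex.I) ∂μ = Complex.exp (-((‖z‖ ^ 2 / 2 : ℝ) : ℂ)) := by
  have := hμ.1
  obtain ⟨u, hu, hg⟩ := h
  have h1 : Tendsto (fun n => ∫ y, Complex.exp ((⟪y, u n⟫ : ℝ) * Complex.I) ∂μ) atTop
      (𝓝 (∫ y, Complex.exp (g y * Complex.I) ∂μ)) := by
    refine tendsto_integral_filter_of_dominated_convergence (fun _ => 1)
      (Eventually.of_forall fun n => by fun_prop) (Eventually.of_forall fun n =>
        Eventually.of_forall fun y => ?_) (integrable_const 1) ?_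
    · rw [Complex.norm_exp_ofReal_mul_I]
    · filter_upwards [hg] with y hy
      exact (Complex.continuous_exp.tendsto _).comp
        (((Complex.continuous_ofReal.tendsto _).comp hy).mul_const _)
  refine tendsto_nhds_unique h1 ?_
  have h2 : ∀ n, ∫ y, Complex.exp ((⟪y, u n⟫ : ℝ) * Complex.I) ∂μ =
      Complex.exp (-((‖R (u n)‖ ^ 2 / 2 : ℝ) : ℂ)) := fun n => by
    rw [hR.norm_apply_sq, ← hμ.2 (u n), charFun_apply]
  simp only [h2]
  exact (Complex.continuous_exp.tendsto _).comp
    ((Complex.continuous_ofReal.tendsto _).comp ((hu.norm.pow 2).div_const 2)).neg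

theorem IsGaussianLimit.map_eq (hR : IsPositiveSqrt Q R) (hμ : IsCenteredGaussian Q μ)
    (h : IsGaussianLimit R μ z g) : μ.map g = gaussianReal 0 (‖z‖ ^ 2).toNNReal := by
  have := hμ.1
  have := Measure.isProbabilityMeasure_map h.aemeasurable
  refine Measure.ext_of_charFun (funext fun t => ?_)
  rw [charFun_apply_real, integral_map h.aemeasurable (by fun_prop), charFun_gaussianReal]
  have h1 := (h.const_mul t).integral_cexp hR hμ
  simp only [Complex.ofReal_mul] at h1
  rw [h1, Real.coe_toNNReal _ (sq_nonneg _), norm_smul, mul_pow, Real.norm_eq_abs, sq_abs]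
  congr 1
  push_cast
  ring

theorem IsGaussianLimit.ae_eq_zero (hR : IsPositiveSqrt Q R) (hμ : IsCenteredGaussian Q μ)
    (h : IsGaussianLimit R μ 0 g) : g =ᵐ[μ] 0 := by
  have h1 := h.map_eq hR hμ
  simp only [norm_zero, ne_eq, OfNat.ofNat_ne_zero, not_false_eq_true, zero_pow,
    Real.toNNReal_zero, gaussianReal_zero_var] at h1
  refine ae_of_ae_map (p := fun x => x = 0) h.aemeasurable ?_
  rw [h1, ae_dirac_eq]
  exact rfl

theorem IsGaussianLimit.ae_eq (hR : IsPositiveSqrt Q R) (hμ : IsCenteredGaussian Q μ)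
    (h : IsGaussianLimit R μ z g) (h' : IsGaussianLimit R μ z g') : g =ᵐ[μ] g' := by
  have h1 := h.add (h'.const_mul (-1))
  rw [neg_one_smul, add_neg_cancel] at h1
  filter_upwards [h1.ae_eq_zero hR hμ] with y hy
  simp only [Pi.zero_apply] at hy
  linarith

theorem IsGaussianLimit.memLp (hR : IsPositiveSqrt Q R) (hμ : IsCenteredGaussian Q μ)
    (h : IsGaussianLimit R μ z g) {p : ENNReal} (hp : p ≠ ⊤) : MemLp g p μ := by
  have h1 : MemLp id p (μ.map g) := by
    rw [h.map_eq hR hμ]; exact memLp_id_gaussianReal' p hp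
  exact (memLp_map_measure_iff h1.1 h.aemeasurable).1 h1

theorem IsGaussianLimit.eLpNorm_two (hR : IsPositiveSqrt Q R) (hμ : IsCenteredGaussian Q μ)
    (h : IsGaussianLimit R μ z g) : eLpNorm g 2 μ = ENNReal.ofReal ‖z‖ := by
  have h1 : MemLp id 2 (μ.map g) := by
    rw [h.map_eq hR hμ]; exact memLp_id_gaussianReal' 2 (by simp)
  rw [show g = id ∘ g from rfl, ← eLpNorm_map_measure h1.1 h.aemeasurable,
    h1.eLpNorm_eq_integral_rpow_norm (by simp) (by simp), h.map_eq hR hμ]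
  have h3 := variance_id_gaussianReal (μ := 0) (v := (‖z‖ ^ 2).toNNReal)
  rw [variance_eq_integral (by fun_prop)] at h3
  simp at h3
  simp only [id_eq, Real.norm_eq_abs, ENNReal.toReal_ofNat, Real.rpow_ofNat, sq_abs, h3]
  rw [← one_div, ← Real.sqrt_eq_rpow, Real.sqrt_sq (norm_nonneg _)]

/-- Subtracting from `⟪·, v⟫` its regression on `g` leaves a functional which is independent
of `g`. -/
theorem IsGaussianLimit.integral_cexp_inner_add (hR : IsPositiveSqrt Q R)
    (hμ : IsCenteredGaussian Q μ) (h : IsGaussianLimit R μ z g) (v : X) :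
    ∫ y, Complex.exp ((⟪y, v⟫ : ℝ) * Complex.I + g y) ∂μ =
      Complex.exp (((‖z‖ ^ 2 / 2 - ‖R v‖ ^ 2 / 2 : ℝ) : ℂ) + (⟪R z, v⟫ : ℝ) * Complex.I) := by
  have := hμ.1
  have hv := isGaussianLimit_inner R μ v
  -- The regression coefficient `α` below needs `z ≠ 0`.
  rcases eq_or_ne z 0 with rfl | hz
  · have h1 : ∫ y, Complex.exp ((⟪y, v⟫ : ℝ) * Complex.I + g y) ∂μ =
        ∫ y, Complex.exp ((⟪y, v⟫ : ℝ) * Complex.I) ∂μ := by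
      refine integral_congr_ae ?_
      filter_upwards [h.ae_eq_zero hR hμ] with y hy
      simp [hy]
    rw [h1, hv.integral_cexp hR hμ]
    congr 1
    simp
  have hz2 : ‖z‖ ^ 2 ≠ 0 := by simpa using hz
  set α : ℝ := ⟪R v, z⟫ / ‖z‖ ^ 2 with hα
  set a : X → ℝ := fun y => ⟪y, v⟫ + (-α) * g y with ha
  have hag : IsGaussianLimit R μ (R v + (-α) • z) a := hv.add (h.const_mul (-α))
  have horth : ⟪R v + (-α) • z, z⟫ = 0 := by
    rw [inner_add_left, inner_smul_left, real_inner_self_eq_norm_sq]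
    simp only [conj_trivial, hα]
    field_simp
    ring
  have hind : IndepFun a g μ := by
    rw [indepFun_iff_charFun_prod hag.aemeasurable h.aemeasurable]
    intro t
    have h1 := ((hag.const_mul t.ofLp.1).add (h.const_mul t.ofLp.2)).integral_cexp hR hμ
    rw [charFun_apply, integral_map (by have := hag.aemeasurable; have := h.aemeasurable; fun_prop)
      (by fun_prop), hag.map_eq hR hμ, h.map_eq hR hμ, charFun_gaussianReal, charFun_gaussianReal]
    have h2 : ‖t.ofLp.1 • (R v + (-α) • z) + t.ofLp.2 • z‖ ^ 2 =
        t.ofLp.1 ^ 2 * ‖R v + (-α) • z‖ ^ 2 + t.ofLp.2 ^ 2 * ‖z‖ ^ 2 := by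
      rw [norm_add_sq_real, inner_smul_left, inner_smul_right, horth, norm_smul, norm_smul]
      simp [mul_pow]
    rw [h2] at h1
    rw [← Complex.exp_add, Real.coe_toNNReal _ (sq_nonneg _), Real.coe_toNNReal _ (sq_nonneg _)]
    convert h1 using 1
    · refine integral_congr_ae (Eventually.of_forall fun y => ?_)
      simp only [WithLp.prod_inner_apply]
      simp [mul_comm]
    · congr 1
      push_cast
      ring
  have h3 : ∀ y, Complex.exp ((⟪y, v⟫ : ℝ) * Complex.I + g y) =
      Complex.exp (a y * Complex.I) * Complex.exp ((1 + α * Complex.I) * g y) := by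
    intro y
    rw [← Complex.exp_add]
    congr 1
    simp only [ha]
    push_cast
    ring
  simp only [h3]
  rw [hind.integral_fun_comp_mul_comp (f := fun x : ℝ => Complex.exp (x * Complex.I))
    (g := fun x : ℝ => Complex.exp ((1 + α * Complex.I) * x)) hag.aemeasurable h.aemeasurable
    (by fun_prop) (by fun_prop), hag.integral_cexp hR hμ,
    show ∫ y, Complex.exp ((1 + α * Complex.I) * g y) ∂μ = _ from
      complexMGF_gaussianReal (h.map_eq hR hμ) _, ← Complex.exp_add,
    Real.coe_toNNReal _ (sq_nonneg _)]
  congr 1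
  have h4 : ‖R v + (-α) • z‖ ^ 2 = ‖R v‖ ^ 2 - α ^ 2 * ‖z‖ ^ 2 := by
    rw [norm_add_sq_real, inner_smul_right, norm_smul, mul_pow, Real.norm_eq_abs, sq_abs]
    have : ⟪R v, z⟫ = α * ‖z‖ ^ 2 := by rw [hα]; field_simp
    rw [this]
    ring
  have h5 : ⟪R z, v⟫ = α * ‖z‖ ^ 2 := by
    rw [hR.1.inner_left_eq_inner_right, real_inner_comm, hα]; field_simp
  rw [h4, h5]
  push_cast
  linear_combination (-(α : ℂ) ^ 2 * ‖z‖ ^ 2 / 2) * (-1) * Complex.I_sq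

theorem IsGaussianLimit.integrable_exp (hR : IsPositiveSqrt Q R) (hμ : IsCenteredGaussian Q μ)
    (h : IsGaussianLimit R μ z g) (c : ℝ) : Integrable (fun y => Real.exp (c * g y)) μ := by
  have h1 := integrable_exp_mul_gaussianReal (μ := 0) (v := (‖z‖ ^ 2).toNNReal) c
  rw [← h.map_eq hR hμ] at h1
  exact h1.comp_aemeasurable h.aemeasurable

/-- **Cameron–Martin formula**: the image of `N_{0,Q}` under the translation by `Q^{1/2} z` has the
density `exp (g - ‖z‖² / 2)`, where `g` is the Gaussian functional attached to `z`. -/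
theorem IsGaussianLimit.map_add_const [CompleteSpace X] (hR : IsPositiveSqrt Q R)
    (hμ : IsCenteredGaussian Q μ) (h : IsGaussianLimit R μ z g) :
    μ.map (fun y => y + R z) =
      μ.withDensity fun y => ENNReal.ofReal (Real.exp (g y - ‖z‖ ^ 2 / 2)) := by
  have := hμ.1
  have hm := h.aemeasurable
  have hint : Integrable (fun y => Real.exp (g y - ‖z‖ ^ 2 / 2)) μ := by
    have := (h.integrable_exp hR hμ 1).mul_const (Real.exp (-(‖z‖ ^ 2 / 2)))
    simpa [← Real.exp_add, sub_eq_add_neg] using this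
  have := isFiniteMeasure_withDensity_ofReal hint.2
  have := Measure.isProbabilityMeasure_map (μ := μ) (f := fun y => y + R z) (by fun_prop)
  refine Measure.ext_of_charFun (funext fun v => ?_)
  rw [charFun_map_add_const, hμ.2, charFun_apply,
    integral_withDensity_eq_integral_toReal_smul₀ (by fun_prop) (by simp)]
  have h1 : ∀ y, (ENNReal.ofReal (Real.exp (g y - ‖z‖ ^ 2 / 2))).toReal •
      Complex.exp ((⟪y, v⟫ : ℝ) * Complex.I) =
      Complex.exp (-((‖z‖ ^ 2 / 2 : ℝ) : ℂ)) * Complex.exp ((⟪y, v⟫ : ℝ) * Complex.I + g y) := by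
    intro y
    rw [ENNReal.toReal_ofReal (Real.exp_nonneg _), Complex.real_smul, Complex.ofReal_exp,
      ← Complex.exp_add, ← Complex.exp_add]
    congr 1
    push_cast
    ring
  simp only [h1]
  rw [integral_const_mul, h.integral_cexp_inner_add hR hμ, ← Complex.exp_add, ← Complex.exp_add,
    ← hR.norm_apply_sq]
  congr 1
  push_cast
  ring

theorem IsGaussianLimit.integral_comp_add [CompleteSpace X] (hR : IsPositiveSqrt Q R)
    (hμ : IsCenteredGaussian Q μ) (h : IsGaussianLimit R μ z g) {φ : X → ℝ} (hφ : Measurable φ) :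
    ∫ y, φ (y + R z) ∂μ = ∫ y, φ y * Real.exp (g y - ‖z‖ ^ 2 / 2) ∂μ := by
  have hm := h.aemeasurable
  rw [← integral_map (φ := fun y => y + R z) (by fun_prop) hφ.aestronglyMeasurable,
    h.map_add_const hR hμ, integral_withDensity_eq_integral_toReal_smul₀ (by fun_prop) (by simp)]
  refine integral_congr_ae (Eventually.of_forall fun y => ?_)
  simp [ENNReal.toReal_ofReal (Real.exp_nonneg _), mul_comm]

theorem cauchy_map_of_dist_eq {α β γ : Type*} [PseudoMetricSpace β] [PseudoMetricSpace γ]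
    {l : Filter α} {f : α → β} {g : α → γ} (h : ∀ a b, dist (f a) (f b) = dist (g a) (g b))
    (hf : Cauchy (map f l)) : Cauchy (map g l) := by
  rw [Metric.cauchy_iff] at hf ⊢
  obtain ⟨hl, hf⟩ := hf
  have := hl.of_map
  refine ⟨inferInstance, fun ε hε => ?_⟩
  obtain ⟨t, ht, hd⟩ := hf ε hε
  refine ⟨g '' (f ⁻¹' t), image_mem_map ht, ?_⟩
  rintro _ ⟨a, ha, rfl⟩ _ ⟨b, hb, rfl⟩
  rw [← h]
  exact hd _ ha _ hb

/-- The partial sums of the white noise series are the functionals `⟪·, u_S⟫` with `R u_S → z`, and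
`v ↦ ⟪·, v⟫` has `L²` norm `‖R v‖`, so that they form a Cauchy net in `L²`. -/
theorem exists_isWhiteNoise [CompleteSpace X] (hR : IsPositiveSqrt Q R)
    (hQ : Q.IsPositive) (hμ : IsCenteredGaussian Q (centeredGaussian Q)) {w : Set X}
    (e : HilbertBasis w ℝ X) {eig : w → ℝ} (he : ∀ k, Q (e k) = eig k • e k)
    (hz : z ∈ (LinearMap.ker (R : X →ₗ[ℝ] X))ᗮ) : ∃ g, IsWhiteNoise Q (R z) g := by
  have := hμ.1
  set u : Finset w → X := fun S => ∑ k ∈ S, (⟪R z, e k⟫ * (eig k)⁻¹) • e k with hu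
  have hlim : Tendsto (fun S => R (u S)) atTop (𝓝 z) := hR.tendsto_apply_sum hQ e he hz
  have hmem : ∀ v, MemLp (fun y => ⟪y, v⟫) 2 (centeredGaussian Q) := fun v =>
    (isGaussianLimit_inner R _ v).memLp hR hμ (by simp)
  set F : Finset w → Lp ℝ 2 (centeredGaussian Q) := fun S => (hmem (u S)).toLp _ with hF
  have hdist : ∀ S S', dist (F S) (F S') = dist (R (u S)) (R (u S')) := fun S S' => by
    rw [dist_eq_norm, dist_eq_norm, hF, ← MemLp.toLp_sub, Lp.norm_toLp, ← map_sub]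
    have h1 := (isGaussianLimit_inner R (centeredGaussian Q) (u S - u S')).eLpNorm_two hR hμ
    have h2 : ((fun y => ⟪y, u S⟫) - fun y => ⟪y, u S'⟫) = fun y => ⟪y, u S - u S'⟫ := by
      ext y; simp [inner_sub_right]
    rw [h2, h1, ENNReal.toReal_ofReal (norm_nonneg _)]
  have hc : CauchySeq F := by
    exact cauchy_map_of_dist_eq (fun S S' => (hdist S S').symm) hlim.cauchy_map
  obtain ⟨G, hG⟩ := cauchySeq_tendsto_of_complete hc
  refine ⟨G, Lp.memLp G, w, e, eig, he, ?_⟩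
  have h1 := (Lp.tendsto_Lp_iff_tendsto_eLpNorm' F G).1 hG
  refine h1.congr fun S => eLpNorm_congr_ae ?_
  filter_upwards [(hmem (u S)).coeFn_toLp] with y hy
  rw [Pi.sub_apply, hy, hu, inner_sum]
  congr 1
  exact Finset.sum_congr rfl fun k _ => by rw [inner_smul_right]; ring

/-- A sequence of partial sums of the white noise series converges almost surely. -/
theorem IsWhiteNoise.isGaussianLimit [CompleteSpace X] (hR : IsPositiveSqrt Q R)
    (hQ : Q.IsPositive) (hz : z ∈ (LinearMap.ker (R : X →ₗ[ℝ] X))ᗮ)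
    (h : IsWhiteNoise Q (R z) g) : IsGaussianLimit R (centeredGaussian Q) z g := by
  obtain ⟨hg, w, e, eig, he, hlim⟩ := h
  have := countable_hilbertBasis e
  have h1 := tendstoInMeasure_of_tendsto_eLpNorm (p := 2) (by simp)
    (f := fun (S : Finset w) y => ∑ k ∈ S, ⟪y, e k⟫ * ⟪R z, e k⟫ * (eig k)⁻¹)
    (fun S => by fun_prop) hg.1 hlim
  obtain ⟨ns, hns, hae⟩ := h1.exists_seq_tendsto_ae'
  refine ⟨fun n => ∑ k ∈ ns n, (⟪R z, e k⟫ * (eig k)⁻¹) • e k,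
    (hR.tendsto_apply_sum hQ e he hz).comp hns, ?_⟩
  filter_upwards [hae] with y hy
  refine hy.congr fun n => ?_
  rw [inner_sum]
  refine Finset.sum_congr rfl fun k _ => ?_
  rw [inner_smul_right]
  ring

end WhiteNoise

/-! ### Hermite polynomials in several variables -/

section Hermite

variable {E : Type*}

/-- `m` pairwise disjoint pairs `(p.1 k, p.2 k)` of elements of `Fin n`, each listed in increasing
order, and listed by increasing first elements. -/
def IsPairing {m n : ℕ} (p : (Fin m → Fin n) × (Fin m → Fin n)) : Prop :=
  (∀ k, p.1 k < p.2 k) ∧ StrictMono p.1 ∧ Function.Injective p.2 ∧ ∀ k l, p.1 k ≠ p.2 l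

theorem isPairing_comp_iff {m n n' : ℕ} {g : Fin n → Fin n'} (hg : StrictMono g)
    (p : (Fin m → Fin n) × (Fin m → Fin n)) : IsPairing (g ∘ p.1, g ∘ p.2) ↔ IsPairing p := by
  refine and_congr (by simp [hg.lt_iff_lt]) (and_congr ?_ (and_congr ?_ ?_))
  · exact ⟨fun h a b hab => hg.lt_iff_lt.1 (h hab), fun h => hg.comp h⟩
  · exact hg.injective.of_comp_iff _
  · simp [hg.injective.ne_iff]

theorem IsPairing.two_mul_le {m n : ℕ} {p : (Fin m → Fin n) × (Fin m → Fin n)}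
    (hp : IsPairing p) : 2 * m ≤ n := by
  have h : Function.Injective (Sum.elim p.1 p.2) :=
    hp.2.1.injective.sumElim hp.2.2.1 hp.2.2.2
  simpa [two_mul] using Fintype.card_le_of_injective _ h

open Classical in
/-- The part of the Hermite polynomial that comes from the choices of `m` disjoint pairs. -/
noncomputable def pairingSum (W : E → ℝ) (c : E → E → ℝ) (n m : ℕ) (v : Fin n → E) : ℝ :=
  ∑ p ∈ (Finset.univ : Finset ((Fin m → Fin n) × (Fin m → Fin n))).filter IsPairing,
    (∏ k, c (v (p.1 k)) (v (p.2 k))) *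
      ∏ j ∈ Finset.univ.filter (fun j : Fin n => ∀ k, j ≠ p.1 k ∧ j ≠ p.2 k), W (v j)

/-- The Hermite polynomial in the variables `W (v i)` with covariances `c (v i) (v j)`, defined by
its recursion formula. -/
noncomputable def hermitePoly (W : E → ℝ) (c : E → E → ℝ) : (n : ℕ) → (Fin n → E) → ℝ
  | 0, _ => 1
  | 1, v => W (v 0)
  | n + 2, v => W (v 0) * hermitePoly W c (n + 1) (fun i => v i.succ) -
      ∑ j : Fin (n + 1), c (v 0) (v j.succ) * hermitePoly W c n (fun i => v (j.succAbove i).succ)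

variable (W : E → ℝ) (c : E → E → ℝ)

theorem pairingSum_zero (n : ℕ) (v : Fin n → E) : pairingSum W c n 0 v = ∏ i, W (v i) := by
  classical
  have h : ∀ p : (Fin 0 → Fin n) × (Fin 0 → Fin n), IsPairing p := fun p =>
    ⟨fun k => k.elim0, fun k => k.elim0, fun k => k.elim0, fun k => k.elim0⟩
  rw [pairingSum, Finset.filter_true_of_mem fun p _ => h p]
  simp

theorem pairingSum_eq_zero {n m : ℕ} (h : n < 2 * m) (v : Fin n → E) :
    pairingSum W c n m v = 0 := by
  classical
  rw [pairingSum, Finset.filter_false_of_mem, Finset.sum_empty]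
  exact fun p _ hp => by have := hp.two_mul_le; omega

/-- A pairing whose first element is not `0` leaves `0` unpaired, as the smallest element of the
pairing is `p.1 0`. -/
theorem IsPairing.exists_eq_succ_comp {m n : ℕ}
    {p : (Fin (m + 1) → Fin (n + 1)) × (Fin (m + 1) → Fin (n + 1))} (hp : IsPairing p)
    (h0 : p.1 0 ≠ 0) :
    ∃ q : (Fin (m + 1) → Fin n) × (Fin (m + 1) → Fin n),
      IsPairing q ∧ (Fin.succ ∘ q.1, Fin.succ ∘ q.2) = p := by
  have h1 : ∀ k, p.1 k ≠ 0 := fun k => by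
    have := hp.2.1.monotone (Fin.zero_le k)
    exact (lt_of_lt_of_le (Fin.pos_of_ne_zero h0) this).ne'
  have h2 : ∀ k, p.2 k ≠ 0 := fun k => ((Fin.pos_of_ne_zero (h1 k)).trans (hp.1 k)).ne'
  choose q1 hq1 using fun k => Fin.exists_succ_eq.2 (h1 k)
  choose q2 hq2 using fun k => Fin.exists_succ_eq.2 (h2 k)
  have hpq : (Fin.succ ∘ q1, Fin.succ ∘ q2) = p := Prod.ext (funext hq1) (funext hq2)
  refine ⟨(q1, q2), ?_, hpq⟩
  rw [← isPairing_comp_iff (Fin.strictMono_succ)]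
  rwa [hpq]

/-- The pairing of `Fin (n + 2)` which consists of the pair `(0, j + 1)` and of the pairs of `q`,
where the elements of `Fin n` number those of `Fin (n + 2)` that are distinct from `0`, `j + 1`. -/
def consPairing {m n : ℕ} (j : Fin (n + 1)) (q : (Fin m → Fin n) × (Fin m → Fin n)) :
    (Fin (m + 1) → Fin (n + 2)) × (Fin (m + 1) → Fin (n + 2)) :=
  (Fin.cons 0 fun k => (j.succAbove (q.1 k)).succ,
    Fin.cons j.succ fun k => (j.succAbove (q.2 k)).succ)

theorem strictMono_succ_succAbove {n : ℕ} (j : Fin (n + 1)) :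
    StrictMono fun i : Fin n => (j.succAbove i).succ :=
  Fin.strictMono_succ.comp (Fin.strictMono_succAbove j)

theorem IsPairing.consPairing {m n : ℕ} (j : Fin (n + 1))
    {q : (Fin m → Fin n) × (Fin m → Fin n)} (hq : IsPairing q) : IsPairing (consPairing j q) := by
  obtain ⟨h1, h2, h3, h4⟩ := hq
  have hg := strictMono_succ_succAbove j
  have hne : ∀ i, (j.succAbove i).succ ≠ j.succ := fun i h =>
    Fin.succAbove_ne j i (Fin.succ_injective _ h)
  refine ⟨fun k => ?_, ?_, ?_, fun k l => ?_⟩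
  · refine Fin.cases ?_ (fun k => ?_) k
    · exact Fin.succ_pos j
    · exact hg (h1 k)
  · refine Fin.strictMono_iff_lt_succ.2 fun k => ?_
    obtain _ | m := m
    · exact k.elim0
    · refine Fin.cases ?_ (fun k => ?_) k
      · exact Fin.succ_pos _
      · exact hg (h2 (Fin.castSucc_lt_succ))
  · refine Fin.cons_injective_iff.2 ⟨?_, hg.injective.comp h3⟩
    rintro ⟨k, hk⟩
    exact hne _ hk
  · refine Fin.cases ?_ (fun k => ?_) k <;> refine Fin.cases ?_ (fun l => ?_) l
    · exact (Fin.succ_ne_zero j).symm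
    · exact (Fin.succ_ne_zero _).symm
    · exact hne _
    · exact hg.injective.ne (h4 k l)

theorem IsPairing.exists_eq_consPairing {m n : ℕ}
    {p : (Fin (m + 1) → Fin (n + 2)) × (Fin (m + 1) → Fin (n + 2))} (hp : IsPairing p)
    (h0 : p.1 0 = 0) :
    ∃ (j : Fin (n + 1)) (q : (Fin m → Fin n) × (Fin m → Fin n)),
      IsPairing q ∧ _root_.consPairing j q = p := by
  obtain ⟨h1, h2, h3, h4⟩ := hp
  obtain ⟨j, hj⟩ : ∃ j, Fin.succ j = p.2 0 := by
    refine Fin.exists_succ_eq.2 ?_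
    rw [← h0]; exact (h1 0).ne'
  have key : ∀ i : Fin (n + 2), i ≠ 0 → i ≠ p.2 0 → ∃ x, (j.succAbove x).succ = i := by
    intro i hi hi'
    obtain ⟨a, rfl⟩ := Fin.exists_succ_eq.2 hi
    obtain ⟨x, hx⟩ := Fin.exists_succAbove_eq (x := a) (y := j) fun h => hi' (by rw [← hj, h])
    exact ⟨x, by rw [hx]⟩
  have hp1 : ∀ k : Fin m, p.1 k.succ ≠ 0 := fun k => by
    rw [← h0]; exact (h2 (Fin.succ_pos k)).ne'
  choose q1 hq1 using fun k : Fin m => key (p.1 k.succ) (hp1 k) (h4 _ _)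
  choose q2 hq2 using fun k : Fin m => key (p.2 k.succ)
    ((Fin.zero_le _).trans_lt (h1 k.succ)).ne' (h3.ne (Fin.succ_ne_zero k))
  refine ⟨j, (q1, q2), ?_, ?_⟩
  · rw [← isPairing_comp_iff (strictMono_succ_succAbove j)]
    refine ⟨fun k => ?_, fun a b hab => ?_, fun a b hab => ?_, fun k l => ?_⟩
    · simpa [hq1, hq2] using h1 k.succ
    · simpa [hq1] using h2 (Fin.succ_lt_succ_iff.2 hab)
    · simp only [Function.comp_apply, hq2] at hab
      exact Fin.succ_injective _ (h3 hab)
    · simpa [hq1, hq2] using h4 k.succ l.succ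
  · refine Prod.ext (funext fun k => ?_) (funext fun k => ?_) <;>
      refine Fin.cases ?_ (fun k => ?_) k
    · exact h0.symm
    · exact hq1 k
    · exact hj
    · exact hq2 k

/-- The index `0` is either unpaired or, in the first pair, paired with some `j + 1`. -/
theorem pairingSum_succ_succ (n m : ℕ) (v : Fin (n + 2) → E) :
    pairingSum W c (n + 2) (m + 1) v =
      W (v 0) * pairingSum W c (n + 1) (m + 1) (fun i => v i.succ) +
      ∑ j : Fin (n + 1), c (v 0) (v j.succ) *
        pairingSum W c n m (fun i => v (j.succAbove i).succ) := by
  classical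
  rw [pairingSum, ← Finset.sum_filter_not_add_sum_filter _ (fun p => p.1 0 = 0)]
  congr 1
  · rw [pairingSum, Finset.mul_sum]
    symm
    refine Finset.sum_nbij (fun q => (Fin.succ ∘ q.1, Fin.succ ∘ q.2)) ?_ ?_ ?_ ?_
    · intro q hq
      simp only [Finset.mem_filter, Finset.mem_univ, true_and] at hq ⊢
      exact ⟨(isPairing_comp_iff (Fin.strictMono_succ) q).2 hq, Fin.succ_ne_zero _⟩
    · intro q _ q' _ h
      simp only [Prod.mk.injEq] at h
      exact Prod.ext ((Fin.succ_injective _).comp_left h.1) ((Fin.succ_injective _).comp_left h.2)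
    · intro p hp
      simp only [Finset.coe_filter, Finset.mem_filter, Finset.mem_univ, true_and,
        mem_ofPred_eq] at hp
      obtain ⟨q, hq, rfl⟩ := hp.1.exists_eq_succ_comp hp.2
      exact ⟨q, by simpa using hq, rfl⟩
    · intro q _
      dsimp only
      rw [Finset.prod_filter, Finset.prod_filter, Fin.prod_univ_succ (n := n + 1)]
      have h0 : ∀ k, (0 : Fin (n + 2)) ≠ (Fin.succ ∘ q.1) k ∧ 0 ≠ (Fin.succ ∘ q.2) k :=
        fun k => ⟨(Fin.succ_ne_zero _).symm, (Fin.succ_ne_zero _).symm⟩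
      rw [if_pos h0]
      simp only [Function.comp_apply, ne_eq, Fin.succ_inj]
      ring
  · simp only [pairingSum, Finset.mul_sum]
    rw [← Finset.sum_product']
    symm
    refine Finset.sum_nbij (fun x => consPairing x.1 x.2) ?_ ?_ ?_ ?_
    · rintro ⟨j, q⟩ hq
      simp only [Finset.mem_product, Finset.mem_filter, Finset.mem_univ, true_and] at hq ⊢
      exact ⟨hq.consPairing j, rfl⟩
    · rintro ⟨j, q⟩ _ ⟨j', q'⟩ _ h
      simp only [consPairing, Prod.mk.injEq] at h
      obtain ⟨h1, h2⟩ := h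
      have hj : j = j' := Fin.succ_injective _ (by simpa using congrFun h2 0)
      subst hj
      refine Prod.ext rfl (Prod.ext (funext fun k => ?_) (funext fun k => ?_))
      · exact (strictMono_succ_succAbove j).injective (by simpa using congrFun h1 k.succ)
      · exact (strictMono_succ_succAbove j).injective (by simpa using congrFun h2 k.succ)
    · intro p hp
      simp only [Finset.coe_filter, Finset.mem_filter, Finset.mem_univ, true_and,
        mem_ofPred_eq] at hp
      obtain ⟨j, q, hq, rfl⟩ := hp.1.exists_eq_consPairing hp.2
      exact ⟨(j, q), by simpa using hq, rfl⟩
    · rintro ⟨j, q⟩ _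
      dsimp only
      rw [Finset.prod_filter, Finset.prod_filter, Fin.prod_univ_succ (n := n + 1),
        Fin.prod_univ_succAbove _ j, Fin.prod_univ_succ (n := m)]
      have h0 : ¬ ∀ k, (0 : Fin (n + 2)) ≠ (consPairing j q).1 k ∧
          (0 : Fin (n + 2)) ≠ (consPairing j q).2 k := fun h => (h 0).1 rfl
      have hj : ¬ ∀ k, j.succ ≠ (consPairing j q).1 k ∧ j.succ ≠ (consPairing j q).2 k :=
        fun h => (h 0).2 rfl
      have hi : ∀ i, (∀ k, (j.succAbove i).succ ≠ (consPairing j q).1 k ∧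
          (j.succAbove i).succ ≠ (consPairing j q).2 k) ↔ ∀ k, i ≠ q.1 k ∧ i ≠ q.2 k := by
        intro i
        simp [Fin.forall_fin_succ, consPairing, Fin.succAbove_ne, Fin.succ_ne_zero]
      rw [if_neg h0, if_neg hj]
      simp only [hi, one_mul]
      simp only [consPairing, Fin.cons_zero, Fin.cons_succ]
      ring

/-- The sum may run up to any bound beyond `n / 2`, as the further terms vanish; the induction uses
different orders with related bounds. -/
theorem hermitePoly_eq_sum_pairingSum :
    ∀ (n M : ℕ) (_ : n < 2 * M) (v : Fin n → E),
      hermitePoly W c n v = ∑ m ∈ Finset.range M, (-1 : ℝ) ^ m * pairingSum W c n m v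
  | _, 0, h, _ => by omega
  | 0, M + 1, _, v => by
    rw [Finset.sum_range_succ', Finset.sum_eq_zero fun m _ => by
      rw [pairingSum_eq_zero W c (by omega), mul_zero]]
    simp [hermitePoly, pairingSum_zero]
  | 1, M + 1, _, v => by
    rw [Finset.sum_range_succ', Finset.sum_eq_zero fun m _ => by
      rw [pairingSum_eq_zero W c (by omega), mul_zero]]
    simp [hermitePoly, pairingSum_zero]
  | n + 2, M + 1, h, v => by
    rw [hermitePoly, hermitePoly_eq_sum_pairingSum (n + 1) (M + 1) (by omega)]
    simp only [hermitePoly_eq_sum_pairingSum n M (by omega)]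
    rw [Finset.sum_range_succ', Finset.sum_range_succ']
    simp only [pairingSum_succ_succ, pairingSum_zero, pow_zero, one_mul]
    rw [Fin.prod_univ_succ (fun i => W (v i)), mul_add, add_sub_right_comm]
    congr 1
    simp only [Finset.mul_sum, mul_add, Finset.sum_add_distrib]
    rw [Finset.sum_comm, sub_eq_add_neg, ← Finset.sum_neg_distrib]
    congr 1
    · exact Finset.sum_congr rfl fun m _ => by ring
    · refine Finset.sum_congr rfl fun j _ => ?_
      rw [← Finset.sum_neg_distrib]
      exact Finset.sum_congr rfl fun m _ => by ring

/-- The recursion formula of the Hermite polynomials is solved by the signed sum over the choices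
of disjoint pairs of indices. -/
theorem hermitePoly_eq (n : ℕ) (v : Fin n → E) :
    hermitePoly W c n v = (∏ i, W (v i)) +
      ∑ m ∈ Finset.Icc 1 (n / 2), (-1 : ℝ) ^ m * pairingSum W c n m v := by
  rw [hermitePoly_eq_sum_pairingSum W c n (n / 2 + 1) (by omega), Finset.range_eq_Ico,
    Finset.sum_eq_sum_Ico_succ_bot (by omega), pairingSum_zero, pow_zero, one_mul]
  rfl

/-- The number of terms of the Hermite polynomial of order `n`, counted with its recursion
formula. -/
def hermiteCount : ℕ → ℝ
  | 0 => 1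
  | 1 => 1
  | n + 2 => hermiteCount (n + 1) + (n + 1) * hermiteCount n

theorem hermiteCount_pos : ∀ n, 0 < hermiteCount n
  | 0 => one_pos
  | 1 => one_pos
  | n + 2 => by
    have h1 := hermiteCount_pos (n + 1)
    have h2 := hermiteCount_pos n
    rw [hermiteCount]
    positivity

theorem abs_hermitePoly_le {σ : E → ℝ} (hσ : ∀ a, 0 ≤ σ a) (hc : ∀ a b, |c a b| ≤ σ a * σ b) :
    ∀ (n : ℕ) (v : Fin n → E),
      |hermitePoly W c n v| ≤ hermiteCount n * ∏ i, (|W (v i)| + σ (v i))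
  | 0, v => by simp [hermitePoly, hermiteCount]
  | 1, v => by simp [hermitePoly, hermiteCount, hσ]
  | n + 2, v => by
    have hpos : ∀ a, 0 ≤ |W a| + σ a := fun a => add_nonneg (abs_nonneg _) (hσ a)
    have hP : 0 ≤ ∏ i : Fin (n + 1), (|W (v i.succ)| + σ (v i.succ)) :=
      Finset.prod_nonneg fun i _ => hpos _
    have h1 : |W (v 0) * hermitePoly W c (n + 1) (fun i => v i.succ)| ≤
        hermiteCount (n + 1) * ∏ i, (|W (v i)| + σ (v i)) := by
      rw [abs_mul, Fin.prod_univ_succ (n := n + 1)]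
      calc |W (v 0)| * |hermitePoly W c (n + 1) (fun i => v i.succ)|
          ≤ (|W (v 0)| + σ (v 0)) * (hermiteCount (n + 1) *
              ∏ i : Fin (n + 1), (|W (v i.succ)| + σ (v i.succ))) := by
            gcongr
            · exact hpos _
            · linarith [hσ (v 0)]
            · exact abs_hermitePoly_le hσ hc (n + 1) _
        _ = _ := by ring
    have h2 : ∀ j : Fin (n + 1), |c (v 0) (v j.succ) *
        hermitePoly W c n (fun i => v (j.succAbove i).succ)| ≤
        hermiteCount n * ∏ i, (|W (v i)| + σ (v i)) := by
      intro j
      rw [abs_mul, Fin.prod_univ_succ (n := n + 1), Fin.prod_univ_succAbove _ j]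
      calc |c (v 0) (v j.succ)| * |hermitePoly W c n (fun i => v (j.succAbove i).succ)|
          ≤ ((|W (v 0)| + σ (v 0)) * (|W (v j.succ)| + σ (v j.succ))) * (hermiteCount n *
              ∏ i : Fin n, (|W (v (j.succAbove i).succ)| + σ (v (j.succAbove i).succ))) := by
            refine mul_le_mul ((hc _ _).trans ?_) (abs_hermitePoly_le hσ hc n _) (abs_nonneg _)
              (mul_nonneg (hpos _) (hpos _))
            exact mul_le_mul (by linarith [abs_nonneg (W (v 0))])
              (by linarith [abs_nonneg (W (v j.succ))]) (hσ _) (hpos _)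
        _ = _ := by ring
    rw [hermitePoly, hermiteCount]
    refine (abs_sub _ _).trans ?_
    have h3 : |∑ j : Fin (n + 1), c (v 0) (v j.succ) *
        hermitePoly W c n (fun i => v (j.succAbove i).succ)| ≤
        (n + 1) * (hermiteCount n * ∏ i, (|W (v i)| + σ (v i))) := by
      refine (Finset.abs_sum_le_sum_abs _ _).trans ((Finset.sum_le_sum fun j _ => h2 j).trans ?_)
      simp
    calc _ ≤ _ := add_le_add h1 h3
      _ = _ := by ring

end Hermite

/-! ### Derivatives along a subspace and iterated derivatives -/

section IterDerivAlong

variable {E X : Type*} [NormedAddCommGroup E] [NormedSpace ℝ E]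
  [NormedAddCommGroup X] [NormedSpace ℝ X]
  {G : Type*} [NormedAddCommGroup G] [NormedSpace ℝ G]

theorem derivAlong_add (ι : E →L[ℝ] X) (F : X → G) (x : X) (h : E) :
    derivAlong ι F (x + ι h) = fderiv ℝ (fun k => F (x + ι k)) h := by
  have h1 : (fun k : E => F (x + ι h + ι k)) = fun k => (fun k => F (x + ι k)) (h + k) := by
    ext k; simp [add_assoc]
  rw [derivAlong, h1, fderiv_comp_add_left (f := fun k => F (x + ι k)), add_zero]

theorem iterDerivAlong_add (ι : E →L[ℝ] X) (f : X → ℝ) (x : X) (n : ℕ) (h : E) :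
    iterDerivAlong ι f n (x + ι h) = iteratedFDeriv ℝ n (fun k => f (x + ι k)) h := by
  induction n generalizing h with
  | zero => rfl
  | succ n ih =>
    have h1 : iterDerivAlong ι f (n + 1) (x + ι h) =
        (derivAlong ι (iterDerivAlong ι f n) (x + ι h)).uncurryLeft := rfl
    rw [h1, derivAlong_add, funext ih]
    rfl

theorem iterDerivAlong_eq (ι : E →L[ℝ] X) (f : X → ℝ) (x : X) (n : ℕ) :
    iterDerivAlong ι f n x = iteratedFDeriv ℝ n (fun k => f (x + ι k)) 0 := by
  simpa using iterDerivAlong_add ι f x n 0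

theorem iterDerivAlong_one_apply (ι : E →L[ℝ] X) (F : X → ℝ) (x : X) (v : Fin 1 → E) :
    iterDerivAlong ι F 1 x v = derivAlong ι F x (v 0) := by
  rw [iterDerivAlong_eq, iteratedFDeriv_one_apply]
  rfl

theorem norm_derivAlong_le (ι : E →L[ℝ] X) (F : X → ℝ) (x : X) :
    ‖derivAlong ι F x‖ ≤ ‖iterDerivAlong ι F 1 x‖ := by
  refine ContinuousLinearMap.opNorm_le_bound _ (norm_nonneg _) fun h => ?_
  rw [← iterDerivAlong_one_apply ι F x fun _ => h]
  simpa using (iterDerivAlong ι F 1 x).le_opNorm fun _ => h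

end IterDerivAlong

section Leibniz

open scoped ContDiff

variable {E : Type*} [NormedAddCommGroup E] [NormedSpace ℝ E] {f : E → ℝ} {x : E}

theorem ContDiffAt.fderiv_apply_const (hf : ContDiffAt ℝ ω f x) (v : E) :
    ContDiffAt ℝ ω (fun h => fderiv ℝ f h v) x :=
  (hf.fderiv_right (m := ω) le_rfl).clm_apply contDiffAt_const

/-- As iterated derivatives are symmetric, the first direction may be the one in which the function
is differentiated first. -/
theorem ContDiffAt.iteratedFDeriv_succ_apply_head (hf : ContDiffAt ℝ ω f x) (n : ℕ)
    (v : Fin (n + 1) → E) :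
    iteratedFDeriv ℝ (n + 1) f x v =
      iteratedFDeriv ℝ n (fun h => fderiv ℝ f h (v 0)) x fun i => v i.succ := by
  rw [← hf.iteratedFDeriv_comp_perm v (finRotate (n + 1)), iteratedFDeriv_succ_apply_right]
  have h1 : (fun h => fderiv ℝ f h (v 0)) =
      (ContinuousLinearMap.apply ℝ ℝ (v 0)) ∘ fun h => fderiv ℝ f h := rfl
  rw [h1, ContinuousLinearMap.iteratedFDeriv_comp_left (n := ω) _ (hf.fderiv_right le_rfl)
    (by simp)]
  have h2 : Fin.init (v ∘ ⇑(finRotate (n + 1))) = fun i => v i.succ := by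
    ext i
    simp [Fin.init]
  simp [h2]

/-- The Leibniz formula for the product with a linear form, at the origin. -/
theorem iteratedFDeriv_linear_mul (ℓ : E →L[ℝ] ℝ) (n : ℕ) {f : E → ℝ} (hf : ContDiffAt ℝ ω f 0)
    (v : Fin (n + 1) → E) :
    iteratedFDeriv ℝ (n + 1) (fun h => ℓ h * f h) 0 v =
      ∑ j : Fin (n + 1), ℓ (v j) * iteratedFDeriv ℝ n f 0 fun i => v (j.succAbove i) := by
  have hℓ : ContDiffAt ℝ ω ℓ 0 := ℓ.contDiff.contDiffAt
  have key : ∀ {f : E → ℝ} (_ : ContDiffAt ℝ ω f 0) (n : ℕ) (v : Fin (n + 1) → E),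
      iteratedFDeriv ℝ (n + 1) (fun h => ℓ h * f h) 0 v =
        ℓ (v 0) * iteratedFDeriv ℝ n f 0 (fun i => v i.succ) +
        iteratedFDeriv ℝ n (fun h => ℓ h * fderiv ℝ f h (v 0)) 0 fun i => v i.succ := by
    intro f hf n v
    have hd : (fun h => fderiv ℝ (fun h => ℓ h * f h) h (v 0)) =ᶠ[𝓝 0]
        fun h => ℓ (v 0) • f h + ℓ h * fderiv ℝ f h (v 0) := by
      filter_upwards [hf.eventually (by simp)] with h hh
      rw [fderiv_fun_mul ℓ.differentiableAt (hh.differentiableAt (by simp))]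
      simp
      ring
    rw [(hℓ.mul hf).iteratedFDeriv_succ_apply_head, (hd.iteratedFDeriv ℝ n).eq_of_nhds,
      fun_iteratedFDeriv_add_apply ((hf.const_smul _).of_le le_top)
        ((hℓ.mul (hf.fderiv_apply_const _)).of_le le_top),
      iteratedFDeriv_const_smul_apply' (hf.of_le le_top)]
    rfl
  induction n generalizing f with
  | zero =>
    rw [key hf]
    simp
  | succ n ih =>
    rw [key hf, ih (hf.fderiv_apply_const _), Fin.sum_univ_succ (n := n + 1)]
    simp only [Fin.zero_succAbove]
    congr 1
    refine Finset.sum_congr rfl fun j _ => ?_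
    rw [hf.iteratedFDeriv_succ_apply_head]
    simp

end Leibniz

/-! ### Derivatives of Gaussian exponentials -/

section GaussianExponential

open scoped ContDiff

variable {E X Ω : Type*} [NormedAddCommGroup E] [NormedSpace ℝ E]
  [NormedAddCommGroup X] [InnerProductSpace ℝ X] [MeasurableSpace Ω]

/-- If the derivatives of `A` at the origin are the moments `∫ ψ ∏ W (v_i)`, then those of the
product of `A` with `exp (-‖Λ h‖² / 2)` are the integrals of the Hermite polynomials. The recursion
on the order replaces `A`, `ψ` by the derivative of `A` in a direction `v`, and by `ψ * W v`. -/
theorem iteratedFDeriv_gaussian_mul (Λ : E →L[ℝ] X) (W : E → Ω → ℝ) (μ : Measure Ω) :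
    ∀ (n : ℕ) {A : E → ℝ} {ψ : Ω → ℝ} (_ : ContDiffAt ℝ ω A 0)
      (_ : ∀ (k : ℕ) (v : Fin k → E), Integrable (fun y => ψ y * ∏ i, W (v i) y) μ)
      (_ : ∀ (k : ℕ) (v : Fin k → E), iteratedFDeriv ℝ k A 0 v = ∫ y, ψ y * ∏ i, W (v i) y ∂μ)
      (v : Fin n → E),
      Integrable (fun y => ψ y *
        hermitePoly (fun h => W h y) (fun a b => ⟪Λ a, Λ b⟫) n v) μ ∧
      iteratedFDeriv ℝ n (fun h => Real.exp (-‖Λ h‖ ^ 2 / 2) * A h) 0 v =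
        ∫ y, ψ y * hermitePoly (fun h => W h y) (fun a b => ⟪Λ a, Λ b⟫) n v ∂μ := by
  have hg : ∀ h, HasFDerivAt (fun h => Real.exp (-‖Λ h‖ ^ 2 / 2))
      (-(Real.exp (-‖Λ h‖ ^ 2 / 2) • (innerSL ℝ (Λ h)).comp Λ)) h := by
    intro h
    have h1 : HasFDerivAt (fun h => ‖Λ h‖ ^ 2) (2 • (innerSL ℝ (Λ h)).comp Λ) h :=
      Λ.hasFDerivAt.norm_sq
    have h2 := (h1.neg.mul_const (2⁻¹ : ℝ)).exp
    refine (h2.congr_fderiv ?_).congr_of_eventuallyEq (Eventually.of_forall fun k => ?_)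
    · ext k
      simp [div_eq_mul_inv]
    · simp [div_eq_mul_inv]
  have hgs : ContDiff ℝ ω fun h => Real.exp (-‖Λ h‖ ^ 2 / 2) :=
    ((Λ.contDiff.norm_sq ℝ).neg.div_const 2).exp
  have step : ∀ {A : E → ℝ} (_ : ContDiffAt ℝ ω A 0) (n : ℕ) (v : Fin (n + 1) → E),
      iteratedFDeriv ℝ (n + 1) (fun h => Real.exp (-‖Λ h‖ ^ 2 / 2) * A h) 0 v =
      iteratedFDeriv ℝ n (fun h => Real.exp (-‖Λ h‖ ^ 2 / 2) * fderiv ℝ A h (v 0)) 0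
        (fun i => v i.succ) -
      iteratedFDeriv ℝ n (fun h => ((innerSL ℝ (Λ (v 0))).comp Λ) h *
        (Real.exp (-‖Λ h‖ ^ 2 / 2) * A h)) 0 (fun i => v i.succ) := by
    intro A hA n v
    have hd : (fun h => fderiv ℝ (fun h => Real.exp (-‖Λ h‖ ^ 2 / 2) * A h) h (v 0)) =ᶠ[𝓝 0]
        fun h => Real.exp (-‖Λ h‖ ^ 2 / 2) * fderiv ℝ A h (v 0) -
          ((innerSL ℝ (Λ (v 0))).comp Λ) h * (Real.exp (-‖Λ h‖ ^ 2 / 2) * A h) := by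
      filter_upwards [hA.eventually (by simp)] with h hh
      rw [((hg h).fun_mul (hh.differentiableAt (by simp)).hasFDerivAt).fderiv]
      simp [real_inner_comm (Λ (v 0))]
      ring
    have hl : ContDiffAt ℝ ω ((innerSL ℝ (Λ (v 0))).comp Λ) 0 :=
      ContinuousLinearMap.contDiff _ |>.contDiffAt
    rw [(hgs.contDiffAt.mul hA).iteratedFDeriv_succ_apply_head, (hd.iteratedFDeriv ℝ n).eq_of_nhds,
      fun_iteratedFDeriv_sub_apply ((hgs.contDiffAt.mul (hA.fderiv_apply_const _)).of_le le_top)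
        ((hl.mul (hgs.contDiffAt.mul hA)).of_le le_top)]
    rfl
  have good : ∀ {A : E → ℝ} {ψ : Ω → ℝ} (_ : ContDiffAt ℝ ω A 0)
      (_ : ∀ (k : ℕ) (v : Fin k → E), Integrable (fun y => ψ y * ∏ i, W (v i) y) μ)
      (_ : ∀ (k : ℕ) (v : Fin k → E), iteratedFDeriv ℝ k A 0 v = ∫ y, ψ y * ∏ i, W (v i) y ∂μ)
      (u : E), (∀ (k : ℕ) (v : Fin k → E), Integrable (fun y => ψ y * W u y * ∏ i, W (v i) y) μ) ∧
      ∀ (k : ℕ) (v : Fin k → E), iteratedFDeriv ℝ k (fun h => fderiv ℝ A h u) 0 v =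
        ∫ y, ψ y * W u y * ∏ i, W (v i) y ∂μ := by
    intro A ψ hA hi hD u
    have h1 : ∀ (k : ℕ) (v : Fin k → E) (y : Ω), ψ y * W u y * ∏ i, W (v i) y =
        ψ y * ∏ i, W ((Fin.cons u v : Fin (k + 1) → E) i) y := fun k v y => by
      rw [Fin.prod_univ_succ]; simp [mul_assoc]
    refine ⟨fun k v => ?_, fun k v => ?_⟩
    · simpa only [h1] using hi (k + 1) (Fin.cons u v)
    · simp only [h1]
      rw [← hD, hA.iteratedFDeriv_succ_apply_head]
      simp
  intro n
  induction n using Nat.twoStepInduction with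
  | zero =>
    intro A ψ hA hi hD v
    have h1 := hi 0 v
    have h2 := hD 0 v
    simp only [Finset.univ_eq_empty, Finset.prod_empty, mul_one, iteratedFDeriv_zero_apply] at h1 h2
    simp [hermitePoly, h1, h2]
  | one =>
    intro A ψ hA hi hD v
    obtain ⟨hi', hD'⟩ := good hA hi hD (v 0)
    have h1 := hi 1 v
    have h2 := hD' 0 (fun i => v i.succ)
    simp only [Finset.univ_unique, Finset.prod_singleton, Fin.default_eq_zero] at h1
    simp only [Finset.univ_eq_empty, Finset.prod_empty, mul_one, iteratedFDeriv_zero_apply] at h2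
    refine ⟨h1, ?_⟩
    rw [step hA]
    simp [hermitePoly, h2]
  | more n ih1 ih2 =>
    intro A ψ hA hi hD v
    obtain ⟨hi', hD'⟩ := good hA hi hD (v 0)
    obtain ⟨hI2, hE2⟩ := ih2 (hA.fderiv_apply_const (v 0)) hi' hD' (fun i => v i.succ)
    have h1 := fun j : Fin (n + 1) => ih1 hA hi hD (fun i => v (j.succAbove i).succ)
    have heq : ∀ y, ψ y * hermitePoly (fun h => W h y) (fun a b => ⟪Λ a, Λ b⟫) (n + 2) v =
        ψ y * W (v 0) y *
          hermitePoly (fun h => W h y) (fun a b => ⟪Λ a, Λ b⟫) (n + 1) (fun i => v i.succ) -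
        ∑ j : Fin (n + 1), ⟪Λ (v 0), Λ (v j.succ)⟫ * (ψ y *
          hermitePoly (fun h => W h y) (fun a b => ⟪Λ a, Λ b⟫) n
            (fun i => v (j.succAbove i).succ)) := by
      intro y
      rw [hermitePoly, mul_sub, Finset.mul_sum]
      congr 1
      · ring
      · exact Finset.sum_congr rfl fun j _ => by ring
    have hI : ∀ j ∈ (Finset.univ : Finset (Fin (n + 1))),
        Integrable (fun y => ⟪Λ (v 0), Λ (v j.succ)⟫ * (ψ y *
          hermitePoly (fun h => W h y) (fun a b => ⟪Λ a, Λ b⟫) n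
            (fun i => v (j.succAbove i).succ))) μ := fun j _ => (h1 j).1.const_mul _
    simp only [heq]
    refine ⟨hI2.sub (integrable_finsetSum _ hI), ?_⟩
    rw [integral_sub hI2 (integrable_finsetSum _ hI), integral_finsetSum _ hI, step hA, hE2,
      iteratedFDeriv_linear_mul _ _ (hgs.contDiffAt.mul hA)]
    congr 1
    refine Finset.sum_congr rfl fun j _ => ?_
    rw [(h1 j).2, integral_const_mul]
    simp

end GaussianExponential

/-! ### Isonormal families: moments and exponentials -/

section Isonormal

open ProbabilityTheory
open scoped ContDiff ENNReal

theorem abs_prod_le_prod_add_norm {E X Ω : Type*} [NormedAddCommGroup E] [NormedSpace ℝ E]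
    [NormedAddCommGroup X] [NormedSpace ℝ X] {Λ : E →L[ℝ] X} {W : E → Ω → ℝ} {n : ℕ}
    (v : Fin n → E) (y : Ω) :
    |∏ i, W (v i) y| ≤ 1 * ∏ i, (|W (v i) y| + ‖Λ (v i)‖) := by
  rw [one_mul, Finset.abs_prod]
  exact Finset.prod_le_prod (fun i _ => abs_nonneg _) fun i _ => by
    linarith [norm_nonneg (Λ (v i))]

theorem aemeasurable_hermitePoly {E Ω : Type*} [MeasurableSpace Ω] {μ : Measure Ω}
    {W : E → Ω → ℝ} (hW : ∀ h, AEMeasurable (W h) μ) (c : E → E → ℝ) : ∀ (n : ℕ) (v : Fin n → E),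
      AEMeasurable (fun y => hermitePoly (fun h => W h y) c n v) μ
  | 0, _ => by simp only [hermitePoly]; fun_prop
  | 1, v => hW (v 0)
  | n + 2, v => by
    simp only [hermitePoly]
    exact ((hW (v 0)).mul (aemeasurable_hermitePoly hW c (n + 1) _)).sub
      (Finset.aemeasurable_fun_sum _ fun j _ => (aemeasurable_hermitePoly hW c n _).const_mul _)

variable {E X Ω : Type*} [NormedAddCommGroup E] [NormedSpace ℝ E]
  [NormedAddCommGroup X] [InnerProductSpace ℝ X] [MeasurableSpace Ω]

/-- `W` is an isonormal Gaussian family indexed by `E`: it is linear up to null sets, and `W h` is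
centered Gaussian with variance `‖Λ h‖²`. -/
structure IsIsonormal (Λ : E →L[ℝ] X) (W : E → Ω → ℝ) (μ : Measure Ω) : Prop where
  aemeasurable : ∀ h, AEMeasurable (W h) μ
  map_eq : ∀ h, μ.map (W h) = gaussianReal 0 (‖Λ h‖ ^ 2).toNNReal
  add : ∀ h k, W (h + k) =ᵐ[μ] fun y => W h y + W k y
  smul : ∀ (c : ℝ) h, W (c • h) =ᵐ[μ] fun y => c * W h y

/-- A form of Hölder's inequality for `n` functions with the same exponent. -/
theorem lintegral_prod_le_mul_prod {μ : Measure Ω} [IsProbabilityMeasure μ] {n : ℕ}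
    {f : Fin n → Ω → ℝ≥0∞} (hf : ∀ i, AEMeasurable (f i) μ) {M : ℝ≥0∞} (hM : 1 ≤ M)
    {a : Fin n → ℝ≥0∞} (h : ∀ i, ∫⁻ y, f i y ^ n ∂μ ≤ M * a i ^ n) :
    ∫⁻ y, ∏ i, f i y ∂μ ≤ M * ∏ i, a i := by
  rcases Nat.eq_zero_or_pos n with rfl | hn
  · simpa using hM
  have hn' : (n : ℝ) ≠ 0 := by positivity
  have h1 := ENNReal.lintegral_prod_norm_pow_le (μ := μ) Finset.univ
    (f := fun i y => f i y ^ n) (p := fun _ => (n : ℝ)⁻¹) (fun i _ => (hf i).pow_const n)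
    (by simp [hn']) (fun _ _ => by positivity)
  have h2 : ∀ x : ℝ≥0∞, (x ^ n) ^ (n : ℝ)⁻¹ = x := fun x => by
    rw [← ENNReal.rpow_natCast, ENNReal.rpow_rpow_inv hn']
  simp only [h2] at h1
  refine h1.trans ?_
  calc ∏ i, (∫⁻ y, f i y ^ n ∂μ) ^ (n : ℝ)⁻¹ ≤ ∏ i, (M ^ (n : ℝ)⁻¹ * a i) := by
        refine Finset.prod_le_prod' fun i _ => ?_
        refine (ENNReal.rpow_le_rpow (h i) (by positivity)).trans ?_
        rw [ENNReal.mul_rpow_of_nonneg _ _ (by positivity), h2]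
    _ = M * ∏ i, a i := by
        rw [Finset.prod_mul_distrib, Finset.prod_const, Finset.card_univ, Fintype.card_fin,
          ← ENNReal.rpow_natCast, ENNReal.rpow_inv_rpow hn']

/-- The moment `∫ (|x| + 1) ^ (2 n)` of the standard Gaussian measure on the line. -/
noncomputable def gaussianMoment (n : ℕ) : ℝ := ∫ x, ((|x| + 1) ^ 2) ^ n ∂(gaussianReal 0 1)

theorem integrable_exp_abs_add_one :
    Integrable (fun x => Real.exp (|x| + 1)) (gaussianReal 0 1) := by
  have h1 := integrable_exp_mul_gaussianReal (μ := 0) (v := 1) 1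
  have h2 := integrable_exp_mul_gaussianReal (μ := 0) (v := 1) (-1)
  refine ((h1.add h2).const_mul (Real.exp 1)).mono' (by fun_prop) (Eventually.of_forall fun x => ?_)
  rw [Real.norm_eq_abs, Real.abs_exp, add_comm, Real.exp_add]
  simp only [Pi.add_apply, one_mul, neg_one_mul]
  gcongr
  exact Real.exp_abs_le x

theorem pow_le_factorial_mul_exp {x : ℝ} (hx : 0 ≤ x) (n : ℕ) :
    x ^ n ≤ n.factorial * Real.exp x := by
  have := Real.pow_div_factorial_le_exp x hx n
  rwa [div_le_iff₀ (by positivity), mul_comm] at this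

theorem integrable_gaussianMoment (n : ℕ) :
    Integrable (fun x : ℝ => ((|x| + 1) ^ 2) ^ n) (gaussianReal 0 1) := by
  refine (integrable_exp_abs_add_one.const_mul ((2 * n).factorial : ℝ)).mono' (by fun_prop)
    (Eventually.of_forall fun x => ?_)
  rw [← pow_mul, Real.norm_eq_abs, abs_of_nonneg (by positivity)]
  exact pow_le_factorial_mul_exp (by positivity) _

theorem one_le_gaussianMoment (n : ℕ) : 1 ≤ gaussianMoment n := by
  have h1 : ∫ _ : ℝ, (1 : ℝ) ∂(gaussianReal 0 1) ≤ gaussianMoment n := by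
    refine integral_mono (integrable_const 1) (integrable_gaussianMoment n) fun x => ?_
    refine one_le_pow₀ (one_le_pow₀ ?_)
    linarith [abs_nonneg x]
  simpa using h1

theorem gaussianMoment_le (n : ℕ) : gaussianMoment n ≤
    (2 * n).factorial * ∫ x, Real.exp (|x| + 1) ∂(gaussianReal 0 1) := by
  rw [← integral_const_mul]
  refine integral_mono (integrable_gaussianMoment n) (integrable_exp_abs_add_one.const_mul _)
    fun x => ?_
  dsimp only
  rw [← pow_mul]
  exact pow_le_factorial_mul_exp (by positivity) _

/-- The factor `n!` is what makes the power series with the moments of order `n`, divided by `n!`,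
as coefficients converge near the origin. -/
theorem sqrt_gaussianMoment_le (n : ℕ) : √(gaussianMoment n) ≤
    2 ^ n * n.factorial * √(∫ x, Real.exp (|x| + 1) ∂(gaussianReal 0 1)) := by
  have h1 : ((2 * n).factorial : ℝ) ≤ (2 ^ n * n.factorial) ^ 2 := by
    have h2 : (2 * n).factorial = (2 * n).choose n * n.factorial * n.factorial := by
      have := Nat.choose_mul_factorial_mul_factorial (show n ≤ 2 * n by omega)
      rw [← this]
      congr 2
      omega
    have h3 : (2 * n).factorial ≤ (2 ^ n * n.factorial) ^ 2 := by
      rw [h2, mul_pow, ← pow_mul, mul_comm n 2, mul_assoc, ← sq]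
      gcongr
      exact Nat.choose_le_two_pow _ _
    exact_mod_cast h3
  refine (Real.sqrt_le_sqrt (gaussianMoment_le n)).trans ?_
  rw [Real.sqrt_mul (by positivity)]
  gcongr
  exact Real.sqrt_le_iff.2 ⟨by positivity, h1⟩

variable {Λ : E →L[ℝ] X} {W : E → Ω → ℝ} {μ : Measure Ω}

theorem IsIsonormal.isProbabilityMeasure (H : IsIsonormal Λ W μ) : IsProbabilityMeasure μ := by
  constructor
  have h1 : μ.map (W 0) univ = 1 := by rw [H.map_eq]; exact measure_univ
  rwa [Measure.map_apply_of_aemeasurable (H.aemeasurable 0) MeasurableSet.univ] at h1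

theorem IsIsonormal.lintegral_comp (H : IsIsonormal Λ W μ) (h : E) {F : ℝ → ℝ≥0∞}
    (hF : Measurable F) :
    ∫⁻ y, F (W h y) ∂μ = ∫⁻ x, F (‖Λ h‖ * x) ∂(gaussianReal 0 1) := by
  have h1 : μ.map (W h) = (gaussianReal 0 1).map (‖Λ h‖ * ·) := by
    rw [H.map_eq, gaussianReal_map_const_mul, mul_zero, mul_one,
      Real.toNNReal_of_nonneg (sq_nonneg _)]
  rw [← lintegral_map' (f := F) hF.aemeasurable (H.aemeasurable h), h1,
    lintegral_map hF (by fun_prop)]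

theorem IsIsonormal.lintegral_prod_le (H : IsIsonormal Λ W μ) {n : ℕ} (v : Fin n → E) :
    ∫⁻ y, ENNReal.ofReal ((∏ i, (|W (v i) y| + ‖Λ (v i)‖)) ^ 2) ∂μ ≤
      ENNReal.ofReal (gaussianMoment n * (∏ i, ‖Λ (v i)‖) ^ 2) := by
  have := H.isProbabilityMeasure
  have hm := H.aemeasurable
  have h1 : ∀ y, ENNReal.ofReal ((∏ i, (|W (v i) y| + ‖Λ (v i)‖)) ^ 2) =
      ∏ i, ENNReal.ofReal ((|W (v i) y| + ‖Λ (v i)‖) ^ 2) := fun y => by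
    rw [← Finset.prod_pow, ENNReal.ofReal_prod_of_nonneg fun i _ => sq_nonneg _]
  simp only [h1]
  have hM := one_le_gaussianMoment n
  rw [ENNReal.ofReal_mul (by linarith), ← Finset.prod_pow,
    ENNReal.ofReal_prod_of_nonneg fun i _ => sq_nonneg _]
  refine lintegral_prod_le_mul_prod (fun i => by have := hm (v i); fun_prop)
    (by simpa using hM) fun i => le_of_eq ?_
  rw [H.lintegral_comp (v i) (F := fun x => ENNReal.ofReal ((|x| + ‖Λ (v i)‖) ^ 2) ^ n)
    (by fun_prop)]
  have h2 : ∀ x : ℝ, ENNReal.ofReal ((|‖Λ (v i)‖ * x| + ‖Λ (v i)‖) ^ 2) ^ n =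
      ENNReal.ofReal (‖Λ (v i)‖ ^ 2) ^ n * ENNReal.ofReal (((|x| + 1) ^ 2) ^ n) := fun x => by
    rw [← ENNReal.ofReal_pow (sq_nonneg _), ← ENNReal.ofReal_pow (sq_nonneg _),
      ← ENNReal.ofReal_mul (by positivity), abs_mul, abs_norm]
    congr 1
    rw [← mul_pow, ← mul_pow]
    ring
  simp only [h2]
  rw [lintegral_const_mul _ (by fun_prop), gaussianMoment, ofReal_integral_eq_lintegral_ofReal
    (integrable_gaussianMoment n) (Eventually.of_forall fun x => by positivity), mul_comm]

theorem IsIsonormal.memLp_prod (H : IsIsonormal Λ W μ) {n : ℕ} (v : Fin n → E) :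
    MemLp (fun y => ∏ i, (|W (v i) y| + ‖Λ (v i)‖)) 2 μ := by
  have hm := H.aemeasurable
  have hmeas : AEMeasurable (fun y => ∏ i, (|W (v i) y| + ‖Λ (v i)‖)) μ :=
    Finset.aemeasurable_fun_prod _ fun i _ => by have := hm (v i); fun_prop
  rw [memLp_two_iff_integrable_sq hmeas.aestronglyMeasurable]
  refine ⟨(hmeas.pow_const 2).aestronglyMeasurable, ?_⟩
  rw [hasFiniteIntegral_iff_ofReal (Eventually.of_forall fun y => sq_nonneg _)]
  exact (H.lintegral_prod_le v).trans_lt ENNReal.ofReal_lt_top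

theorem IsIsonormal.integral_prod_sq_le (H : IsIsonormal Λ W μ) {n : ℕ} (v : Fin n → E) :
    ∫ y, (∏ i, (|W (v i) y| + ‖Λ (v i)‖)) ^ 2 ∂μ ≤
      gaussianMoment n * (∏ i, ‖Λ (v i)‖) ^ 2 := by
  have hM := one_le_gaussianMoment n
  rw [integral_eq_lintegral_of_nonneg_ae (Eventually.of_forall fun y => sq_nonneg _)
    ((H.memLp_prod v).1.pow 2)]
  exact ENNReal.toReal_le_of_le_ofReal (by positivity) (H.lintegral_prod_le v)

/-- Functions dominated by `∏ (|W (v_i)| + ‖Λ v_i‖)`, such as products and Hermite polynomials of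
the `W (v_i)`, pair with square integrable functions, multilinearly bounded in `Λ v_i`. -/
theorem IsIsonormal.integrable_mul_and_abs_integral_le (H : IsIsonormal Λ W μ) {ψ F : Ω → ℝ}
    (hψ : MemLp ψ 2 μ) {n : ℕ} (v : Fin n → E) (hF : AEStronglyMeasurable F μ) {K : ℝ} (hK : 0 ≤ K)
    (hle : ∀ y, |F y| ≤ K * ∏ i, (|W (v i) y| + ‖Λ (v i)‖)) :
    Integrable (fun y => ψ y * F y) μ ∧
      |∫ y, ψ y * F y ∂μ| ≤
        √(∫ y, ψ y ^ 2 ∂μ) * (K * √(gaussianMoment n)) * ∏ i, ‖Λ (v i)‖ := by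
  have hP := H.memLp_prod v
  have hI : Integrable (fun y => |ψ y| * ∏ i, (|W (v i) y| + ‖Λ (v i)‖)) μ :=
    hψ.abs.integrable_mul hP
  have hpos : ∀ y, 0 ≤ ∏ i, (|W (v i) y| + ‖Λ (v i)‖) := fun y =>
    Finset.prod_nonneg fun i _ => by positivity
  have hle' : ∀ y, ‖ψ y * F y‖ ≤ K * (|ψ y| * ∏ i, (|W (v i) y| + ‖Λ (v i)‖)) := fun y => by
    rw [norm_mul, Real.norm_eq_abs, Real.norm_eq_abs]
    calc |ψ y| * |F y| ≤ |ψ y| * (K * ∏ i, (|W (v i) y| + ‖Λ (v i)‖)) := by gcongr; exact hle y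
      _ = _ := by ring
  refine ⟨(hI.const_mul K).mono' (hψ.1.mul hF) (Eventually.of_forall hle'), ?_⟩
  refine (norm_integral_le_of_norm_le (hI.const_mul K) (Eventually.of_forall hle')).trans ?_
  rw [integral_const_mul]
  have h1 := integral_mul_le_Lp_mul_Lq_of_nonneg (μ := μ) (Real.HolderConjugate.two_two)
    (Eventually.of_forall fun y => abs_nonneg (ψ y)) (Eventually.of_forall hpos)
    (by simpa using (show MemLp (fun y => |ψ y|) 2 μ from hψ.abs)) (by simpa using hP)
  simp only [Real.rpow_ofNat, sq_abs, ← Real.sqrt_eq_rpow] at h1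
  have h2 : √(∫ y, (∏ i, (|W (v i) y| + ‖Λ (v i)‖)) ^ 2 ∂μ) ≤
      √(gaussianMoment n) * ∏ i, ‖Λ (v i)‖ := by
    refine (Real.sqrt_le_sqrt (H.integral_prod_sq_le v)).trans (le_of_eq ?_)
    have hM := one_le_gaussianMoment n
    rw [Real.sqrt_mul (by linarith), Real.sqrt_sq (Finset.prod_nonneg fun i _ => norm_nonneg _)]
  calc K * ∫ y, |ψ y| * ∏ i, (|W (v i) y| + ‖Λ (v i)‖) ∂μ
      ≤ K * (√(∫ y, ψ y ^ 2 ∂μ) * (√(gaussianMoment n) * ∏ i, ‖Λ (v i)‖)) := by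
        gcongr
        exact h1.trans (by gcongr)
    _ = _ := by ring

theorem IsIsonormal.aestronglyMeasurable_prod (H : IsIsonormal Λ W μ) {n : ℕ} (v : Fin n → E) :
    AEStronglyMeasurable (fun y => ∏ i, W (v i) y) μ :=
  (Finset.aemeasurable_fun_prod _ fun i _ => H.aemeasurable (v i)).aestronglyMeasurable

/-- The mixed moments `∫ ψ W(v_1) ⋯ W(v_n)`, as a bounded multilinear form. -/
theorem IsIsonormal.exists_moment (H : IsIsonormal Λ W μ) {ψ : Ω → ℝ} (hψ : MemLp ψ 2 μ) (n : ℕ) :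
    ∃ q : ContinuousMultilinearMap ℝ (fun _ : Fin n => E) ℝ,
      (∀ v, q v = ∫ y, ψ y * ∏ i, W (v i) y ∂μ) ∧
      ‖q‖ ≤ √(∫ y, ψ y ^ 2 ∂μ) * √(gaussianMoment n) * ‖Λ‖ ^ n := by
  have hI : ∀ v : Fin n → E, Integrable (fun y => ψ y * ∏ i, W (v i) y) μ := fun v =>
    (H.integrable_mul_and_abs_integral_le hψ v (H.aestronglyMeasurable_prod v) zero_le_one
      (abs_prod_le_prod_add_norm v)).1
  have hup : ∀ [DecidableEq (Fin n)] (v : Fin n → E) (i : Fin n) (x : E) (y : Ω),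
      ∏ j, W (Function.update v i x j) y = W x y * ∏ j ∈ Finset.univ.erase i, W (v j) y := by
    intro _ v i x y
    rw [← Finset.mul_prod_erase _ _ (Finset.mem_univ i), Function.update_self]
    congr 1
    refine Finset.prod_congr (by congr!) fun j hj => ?_
    rw [Function.update_of_ne (Finset.ne_of_mem_erase hj)]
  let q : MultilinearMap ℝ (fun _ : Fin n => E) ℝ :=
    { toFun := fun v => ∫ y, ψ y * ∏ i, W (v i) y ∂μ
      map_update_add' := fun v i a b => by
        rw [← integral_add (hI _) (hI _)]
        refine integral_congr_ae ?_
        filter_upwards [H.add a b] with y hy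
        rw [hup, hup, hup, hy]
        ring
      map_update_smul' := fun v i c a => by
        rw [smul_eq_mul, ← integral_const_mul]
        refine integral_congr_ae ?_
        filter_upwards [H.smul c a] with y hy
        rw [hup, hup, hy]
        ring }
  refine ⟨q.mkContinuous (√(∫ y, ψ y ^ 2 ∂μ) * √(gaussianMoment n) * ‖Λ‖ ^ n) fun v => ?_,
    fun v => rfl, MultilinearMap.mkContinuous_norm_le _ (by positivity) _⟩
  refine (H.integrable_mul_and_abs_integral_le hψ v (H.aestronglyMeasurable_prod v) zero_le_one
      (abs_prod_le_prod_add_norm v)).2.trans ?_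
  have h1 : ∏ i, ‖Λ (v i)‖ ≤ ‖Λ‖ ^ n * ∏ i, ‖v i‖ := by
    calc ∏ i, ‖Λ (v i)‖ ≤ ∏ i, (‖Λ‖ * ‖v i‖) :=
          Finset.prod_le_prod (fun i _ => norm_nonneg _) fun i _ => Λ.le_opNorm _
      _ = _ := by rw [Finset.prod_mul_distrib]; simp
  calc _ ≤ √(∫ y, ψ y ^ 2 ∂μ) * (1 * √(gaussianMoment n)) * (‖Λ‖ ^ n * ∏ i, ‖v i‖) := by gcongr
    _ = _ := by ring

theorem IsIsonormal.integrable_exp_mul (H : IsIsonormal Λ W μ) (h : E) (c : ℝ) :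
    Integrable (fun y => Real.exp (c * W h y)) μ := by
  have h1 := integrable_exp_mul_gaussianReal (μ := 0) (v := (‖Λ h‖ ^ 2).toNNReal) c
  rw [← H.map_eq h] at h1
  exact h1.comp_aemeasurable (H.aemeasurable h)

theorem IsIsonormal.integrable_mul_exp_abs (H : IsIsonormal Λ W μ) {ψ : Ω → ℝ} (hψ : MemLp ψ 2 μ)
    (h : E) : Integrable (fun y => |ψ y| * Real.exp |W h y|) μ := by
  have hm := H.aemeasurable h
  have hmeas : AEStronglyMeasurable (fun y => Real.exp |W h y|) μ :=
    AEMeasurable.aestronglyMeasurable (by fun_prop)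
  refine hψ.abs.integrable_mul ((memLp_two_iff_integrable_sq hmeas).2 ?_)
  refine ((H.integrable_exp_mul h 2).add (H.integrable_exp_mul h (-2))).mono' (hmeas.pow 2)
    (Eventually.of_forall fun y => ?_)
  rw [Real.norm_eq_abs, abs_of_nonneg (by positivity), sq, ← Real.exp_add, ← two_mul]
  have := Real.exp_abs_le (2 * W h y)
  rw [abs_mul, abs_two] at this
  simpa using this

/-- The function `h ↦ ∫ ψ exp (W h)` is analytic at the origin, and its derivatives there are the
moments. -/
theorem IsIsonormal.analytic_integral_mul_exp (H : IsIsonormal Λ W μ) {ψ : Ω → ℝ}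
    (hψ : MemLp ψ 2 μ) :
    ContDiffAt ℝ ω (fun h => ∫ y, ψ y * Real.exp (W h y) ∂μ) 0 ∧
    ∀ (n : ℕ) (v : Fin n → E),
      iteratedFDeriv ℝ n (fun h => ∫ y, ψ y * Real.exp (W h y) ∂μ) 0 v =
        ∫ y, ψ y * ∏ i, W (v i) y ∂μ := by
  choose q hq hqn using H.exists_moment hψ
  set p : FormalMultilinearSeries ℝ E ℝ := fun n => (n.factorial : ℝ)⁻¹ • q n with hp
  set D := √(∫ x, Real.exp (|x| + 1) ∂(gaussianReal 0 1)) with hD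
  -- The norms of the coefficients grow like `(2 ‖Λ‖) ^ n`.
  have hr : 0 < (2 * (‖Λ‖ + 1))⁻¹ := by positivity
  set r : NNReal := ⟨(2 * (‖Λ‖ + 1))⁻¹, hr.le⟩ with hrdef
  have hball : HasFPowerSeriesOnBall (fun h => ∫ y, ψ y * Real.exp (W h y) ∂μ) p 0 r := by
    refine ⟨p.le_radius_of_bound (√(∫ y, ψ y ^ 2 ∂μ) * D) fun n => ?_, ?_, fun {h} _ => ?_⟩
    · have h1 : ‖p n‖ ≤ (n.factorial : ℝ)⁻¹ *
          (√(∫ y, ψ y ^ 2 ∂μ) * (2 ^ n * n.factorial * D) * ‖Λ‖ ^ n) := by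
        rw [hp, norm_smul, norm_inv, Real.norm_natCast]
        gcongr
        refine (hqn n).trans ?_
        gcongr
        exact sqrt_gaussianMoment_le n
      have h2 : 2 * ‖Λ‖ * r ≤ 1 := by
        change 2 * ‖Λ‖ * (2 * (‖Λ‖ + 1))⁻¹ ≤ 1
        rw [← div_eq_mul_inv, div_le_one (by positivity)]
        linarith
      calc ‖p n‖ * (r : ℝ) ^ n ≤ (n.factorial : ℝ)⁻¹ *
          (√(∫ y, ψ y ^ 2 ∂μ) * (2 ^ n * n.factorial * D) * ‖Λ‖ ^ n) * (r : ℝ) ^ n := by gcongr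
        _ = (n.factorial : ℝ)⁻¹ * n.factorial * (√(∫ y, ψ y ^ 2 ∂μ) * D) * (2 * ‖Λ‖ * r) ^ n := by
          rw [mul_pow, mul_pow]; ring
        _ = √(∫ y, ψ y ^ 2 ∂μ) * D * (2 * ‖Λ‖ * r) ^ n := by
          rw [inv_mul_cancel₀ (by positivity), one_mul]
        _ ≤ √(∫ y, ψ y ^ 2 ∂μ) * D * 1 := by
          gcongr
          exact pow_le_one₀ (by positivity) h2
        _ = _ := mul_one _
    · rw [ENNReal.coe_pos]; exact hr
    · rw [zero_add]
      have h1 : ∀ n, p n (fun _ => h) = ∫ y, ψ y * ((n.factorial : ℝ)⁻¹ * W h y ^ n) ∂μ := by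
        intro n
        rw [hp, smul_apply, hq, smul_eq_mul, ← integral_const_mul]
        congr with y
        simp
        ring
      simp only [h1]
      have hsum : ∀ x : ℝ, HasSum (fun n : ℕ => (n.factorial : ℝ)⁻¹ * x ^ n) (Real.exp x) := by
        intro x
        have := NormedSpace.exp_series_hasSum_exp' (𝕂 := ℝ) x
        rw [← Real.exp_eq_exp_ℝ] at this
        exact this
      have hm := H.aemeasurable h
      have hψm := hψ.1
      refine hasSum_integral_of_dominated_convergence
        (fun n y => |ψ y| * ((n.factorial : ℝ)⁻¹ * |W h y| ^ n)) (fun n => ?_)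
        (fun n => Eventually.of_forall fun y => ?_)
        (Eventually.of_forall fun y => ((hsum |W h y|).mul_left |ψ y|).summable) ?_
        (Eventually.of_forall fun y => (hsum (W h y)).mul_left (ψ y))
      · exact hψm.mul (AEMeasurable.aestronglyMeasurable (by fun_prop))
      · rw [norm_mul, norm_mul, norm_pow, norm_inv, Real.norm_natCast]
        exact le_rfl
      · have h2 : (fun y => ∑' n : ℕ, |ψ y| * ((n.factorial : ℝ)⁻¹ * |W h y| ^ n)) =
            fun y => |ψ y| * Real.exp |W h y| :=
          funext fun y => ((hsum |W h y|).mul_left |ψ y|).tsum_eq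
        rw [h2]
        exact H.integrable_mul_exp_abs hψ h
  refine ⟨hball.analyticAt.contDiffAt, fun n v => ?_⟩
  rw [hball.iteratedFDeriv_eq_sum_of_completeSpace]
  have h3 : ∀ σ : Equiv.Perm (Fin n), p n (fun i => v (σ i)) = (n.factorial : ℝ)⁻¹ *
      ∫ y, ψ y * ∏ i, W (v i) y ∂μ := fun σ => by
    rw [hp, smul_apply, hq, smul_eq_mul]
    congr 2 with y
    rw [Equiv.prod_comp σ (fun i => W (v i) y)]
  simp only [h3]
  rw [Finset.sum_const, Finset.card_univ, Fintype.card_perm, Fintype.card_fin, nsmul_eq_mul,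
    ← mul_assoc, mul_inv_cancel₀ (by positivity), one_mul]

/-- The function `h ↦ ∫ ψ exp (W h - ‖Λ h‖² / 2)` is analytic at the origin, and its derivatives
there are the integrals of Hermite polynomials. -/
theorem IsIsonormal.analytic_integral_mul_wickExp (H : IsIsonormal Λ W μ) {ψ : Ω → ℝ}
    (hψ : MemLp ψ 2 μ) :
    ContDiffAt ℝ ω (fun h => ∫ y, ψ y * Real.exp (W h y - ‖Λ h‖ ^ 2 / 2) ∂μ) 0 ∧
    ∀ (n : ℕ) (v : Fin n → E),
      Integrable (fun y => ψ y *
        hermitePoly (fun h => W h y) (fun a b => ⟪Λ a, Λ b⟫) n v) μ ∧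
      iteratedFDeriv ℝ n (fun h => ∫ y, ψ y * Real.exp (W h y - ‖Λ h‖ ^ 2 / 2) ∂μ) 0 v =
        ∫ y, ψ y * hermitePoly (fun h => W h y) (fun a b => ⟪Λ a, Λ b⟫) n v ∂μ := by
  obtain ⟨hA, hD⟩ := H.analytic_integral_mul_exp hψ
  have h1 : (fun h => ∫ y, ψ y * Real.exp (W h y - ‖Λ h‖ ^ 2 / 2) ∂μ) =
      fun h => Real.exp (-‖Λ h‖ ^ 2 / 2) * ∫ y, ψ y * Real.exp (W h y) ∂μ := by
    ext h
    rw [← integral_const_mul]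
    congr with y
    rw [sub_eq_add_neg, Real.exp_add, neg_div]
    ring
  have hgs : ContDiff ℝ ω fun h => Real.exp (-‖Λ h‖ ^ 2 / 2) :=
    ((Λ.contDiff.norm_sq ℝ).neg.div_const 2).exp
  rw [h1]
  exact ⟨hgs.contDiffAt.mul hA, fun n v => iteratedFDeriv_gaussian_mul Λ W μ n hA
    (fun k v => (H.integrable_mul_and_abs_integral_le hψ v (H.aestronglyMeasurable_prod v)
      zero_le_one (abs_prod_le_prod_add_norm v)).1) hD v⟩

/-- The constant `C_n` in the estimates of the derivatives. -/
noncomputable def hermiteConst (n : ℕ) : ℝ := hermiteCount n * √(gaussianMoment n)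

theorem hermiteConst_pos (n : ℕ) : 0 < hermiteConst n :=
  mul_pos (hermiteCount_pos n) (Real.sqrt_pos.2 (one_pos.trans_le (one_le_gaussianMoment n)))

theorem IsIsonormal.abs_integral_mul_hermitePoly_le (H : IsIsonormal Λ W μ) {ψ : Ω → ℝ}
    (hψ : MemLp ψ 2 μ) {n : ℕ} (v : Fin n → E) :
    |∫ y, ψ y * hermitePoly (fun h => W h y) (fun a b => ⟪Λ a, Λ b⟫) n v ∂μ| ≤
      √(∫ y, ψ y ^ 2 ∂μ) * hermiteConst n * ‖Λ‖ ^ n * ∏ i, ‖v i‖ := by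
  refine (H.integrable_mul_and_abs_integral_le hψ v
    (aemeasurable_hermitePoly H.aemeasurable _ n v).aestronglyMeasurable (hermiteCount_pos n).le
    fun y => abs_hermitePoly_le _ _ (σ := fun a => ‖Λ a‖) (fun a => norm_nonneg _)
      (fun a b => abs_real_inner_le_norm _ _) n v).2.trans ?_
  have h1 : ∏ i, ‖Λ (v i)‖ ≤ ‖Λ‖ ^ n * ∏ i, ‖v i‖ := by
    calc ∏ i, ‖Λ (v i)‖ ≤ ∏ i, (‖Λ‖ * ‖v i‖) :=
          Finset.prod_le_prod (fun i _ => norm_nonneg _) fun i _ => Λ.le_opNorm _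
      _ = _ := by rw [Finset.prod_mul_distrib]; simp
  have := (hermiteConst_pos n).le
  calc _ ≤ √(∫ y, ψ y ^ 2 ∂μ) * hermiteConst n * (‖Λ‖ ^ n * ∏ i, ‖v i‖) := by
        rw [hermiteConst] at *; gcongr
    _ = _ := by ring

end Isonormal

/-! ### Smoothing by a Gaussian measure along the Cameron–Martin space -/

section BoundedContinuous

variable {X : Type*} [NormedAddCommGroup X] [MeasurableSpace X] [BorelSpace X]
  [SecondCountableTopology X] {μ : Measure X} {m : X → X}

theorem BoundedContinuousFunction.memLp_comp_add [IsProbabilityMeasure μ] (φ : X →ᵇ ℝ) (a : X) :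
    MemLp (fun y => φ (y + a)) 2 μ :=
  MemLp.of_bound (by fun_prop) ‖φ‖ (Eventually.of_forall fun y => φ.norm_coe_le_norm _)

theorem tendsto_integral_sq_sub [IsProbabilityMeasure μ] (hm : Continuous m) (φ : X →ᵇ ℝ) (x : X) :
    Tendsto (fun x' => ∫ y, (φ (y + m x') - φ (y + m x)) ^ 2 ∂μ) (𝓝 x) (𝓝 0) := by
  have h0 : (∫ y, (φ (y + m x) - φ (y + m x)) ^ 2 ∂μ) = 0 := by simp
  rw [← h0]
  refine tendsto_integral_filter_of_dominated_convergence (fun _ => (2 * ‖φ‖) ^ 2)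
    (Eventually.of_forall fun x' => by fun_prop) (Eventually.of_forall fun x' =>
      Eventually.of_forall fun y => ?_) (integrable_const _) (Eventually.of_forall fun y => ?_)
  · rw [Real.norm_eq_abs, abs_pow]
    gcongr
    have h1 := φ.norm_coe_le_norm (y + m x')
    have h2 := φ.norm_coe_le_norm (y + m x)
    have h3 := norm_sub_le (φ (y + m x')) (φ (y + m x))
    rw [Real.norm_eq_abs (_ - _)] at h3
    linarith
  · have : Continuous fun x' => (φ (y + m x') - φ (y + m x)) ^ 2 := by fun_prop
    exact this.tendsto x

end BoundedContinuous

section Smoothing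

variable {X E : Type*} [NormedAddCommGroup X] [InnerProductSpace ℝ X]
  [MeasurableSpace X] [BorelSpace X] [SecondCountableTopology X]
  [NormedAddCommGroup E] [NormedSpace ℝ E] {Q R : X →L[ℝ] X} {μ : Measure X}
  {Λ : E →L[ℝ] X} {W : E → X → ℝ} {ι : E →L[ℝ] X} {m : X → X}

theorem isIsonormal_of_isGaussianLimit (hR : IsPositiveSqrt Q R) (hμ : IsCenteredGaussian Q μ)
    (hW : ∀ h, IsGaussianLimit R μ (Λ h) (W h)) : IsIsonormal Λ W μ where
  aemeasurable h := (hW h).aemeasurable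
  map_eq h := (hW h).map_eq hR hμ
  add h k := (hW (h + k)).ae_eq hR hμ (by simpa using (hW h).add (hW k))
  smul c h := (hW (c • h)).ae_eq hR hμ (by simpa using (hW h).const_mul c)

variable [CompleteSpace X]

/-- By the Cameron–Martin formula, moving the base point along `E` amounts to a change of density,
so that no regularity of `φ` is needed to differentiate. -/
theorem integral_comp_mean_add (hR : IsPositiveSqrt Q R) (hμ : IsCenteredGaussian Q μ)
    (hW : ∀ h, IsGaussianLimit R μ (Λ h) (W h))
    (hmι : ∀ x h, m (x + ι h) = m x + R (Λ h)) (φ : X →ᵇ ℝ) (x : X) :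
    (fun h => ∫ y, φ (y + m (x + ι h)) ∂μ) =
      fun h => ∫ y, φ (y + m x) * Real.exp (W h y - ‖Λ h‖ ^ 2 / 2) ∂μ := by
  ext h
  rw [← (hW h).integral_comp_add hR hμ (φ := fun y => φ (y + m x)) (by fun_prop)]
  refine integral_congr_ae (Eventually.of_forall fun y => ?_)
  simp only [hmι]
  congr 1
  abel

theorem integrable_and_iterDerivAlong_eq (hR : IsPositiveSqrt Q R) (hμ : IsCenteredGaussian Q μ)
    (hW : ∀ h, IsGaussianLimit R μ (Λ h) (W h))
    (hmι : ∀ x h, m (x + ι h) = m x + R (Λ h)) (φ : X →ᵇ ℝ) (n : ℕ) (x : X) (v : Fin n → E) :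
    Integrable (fun y => φ (y + m x) *
      hermitePoly (fun h => W h y) (fun a b => ⟪Λ a, Λ b⟫) n v) μ ∧
    iterDerivAlong ι (fun x => ∫ y, φ (y + m x) ∂μ) n x v =
      ∫ y, φ (y + m x) * hermitePoly (fun h => W h y) (fun a b => ⟪Λ a, Λ b⟫) n v ∂μ := by
  have := hμ.1
  rw [iterDerivAlong_eq, integral_comp_mean_add hR hμ hW hmι]
  exact ((isIsonormal_of_isGaussianLimit hR hμ hW).analytic_integral_mul_wickExp
    (φ.memLp_comp_add (m x))).2 n v

theorem norm_iterDerivAlong_le (hR : IsPositiveSqrt Q R) (hμ : IsCenteredGaussian Q μ)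
    (hW : ∀ h, IsGaussianLimit R μ (Λ h) (W h))
    (hmι : ∀ x h, m (x + ι h) = m x + R (Λ h)) (φ : X →ᵇ ℝ) (n : ℕ) (x : X) :
    ‖iterDerivAlong ι (fun x => ∫ y, φ (y + m x) ∂μ) n x‖ ≤ hermiteConst n * ‖Λ‖ ^ n * ‖φ‖ := by
  have := hμ.1
  have hC := (hermiteConst_pos n).le
  refine ContinuousMultilinearMap.opNorm_le_bound (by positivity) fun v => ?_
  rw [(integrable_and_iterDerivAlong_eq hR hμ hW hmι φ n x v).2, Real.norm_eq_abs]
  refine ((isIsonormal_of_isGaussianLimit hR hμ hW).abs_integral_mul_hermitePoly_le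
    (φ.memLp_comp_add (m x)) v).trans ?_
  have h1 : √(∫ y, φ (y + m x) ^ 2 ∂μ) ≤ ‖φ‖ := by
    rw [Real.sqrt_le_left (norm_nonneg _)]
    refine (integral_mono_of_nonneg (Eventually.of_forall fun y => sq_nonneg _)
      (integrable_const (‖φ‖ ^ 2)) (Eventually.of_forall fun y => ?_)).trans (by simp)
    exact sq_le_sq.2 (by simpa using φ.norm_coe_le_norm (y + m x))
  calc _ ≤ ‖φ‖ * hermiteConst n * ‖Λ‖ ^ n * ∏ i, ‖v i‖ := by gcongr
    _ = _ := by ring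

/-- The modulus of continuity of the differentials of order `n` is that of `x ↦ φ (· + m x)` in
`L²(μ)`. -/
theorem continuous_iterDerivAlong (hR : IsPositiveSqrt Q R) (hμ : IsCenteredGaussian Q μ)
    (hW : ∀ h, IsGaussianLimit R μ (Λ h) (W h)) (hm : Continuous m)
    (hmι : ∀ x h, m (x + ι h) = m x + R (Λ h)) (φ : X →ᵇ ℝ) (n : ℕ) :
    Continuous (iterDerivAlong ι (fun x => ∫ y, φ (y + m x) ∂μ) n) := by
  have := hμ.1
  have hC := (hermiteConst_pos n).le
  have H := isIsonormal_of_isGaussianLimit hR hμ hW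
  refine continuous_iff_continuousAt.2 fun x => ?_
  rw [ContinuousAt, tendsto_iff_norm_sub_tendsto_zero]
  have hlim := ((Real.continuous_sqrt.tendsto _).comp
    (tendsto_integral_sq_sub (μ := μ) hm φ x)).mul_const (hermiteConst n * ‖Λ‖ ^ n)
  rw [Real.sqrt_zero, zero_mul] at hlim
  refine squeeze_zero (fun _ => norm_nonneg _) (fun x' => ?_) hlim
  refine ContinuousMultilinearMap.opNorm_le_bound
    (mul_nonneg (Real.sqrt_nonneg _) (by positivity)) fun v => ?_
  obtain ⟨i1, e1⟩ := integrable_and_iterDerivAlong_eq hR hμ hW hmι φ n x' v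
  obtain ⟨i2, e2⟩ := integrable_and_iterDerivAlong_eq hR hμ hW hmι φ n x v
  rw [sub_apply, e1, e2, ← integral_sub i1 i2, Real.norm_eq_abs]
  simp only [← sub_mul]
  refine (H.abs_integral_mul_hermitePoly_le
    ((φ.memLp_comp_add (m x')).sub (φ.memLp_comp_add (m x))) v).trans (le_of_eq ?_)
  simp only [Function.comp_apply, Pi.sub_apply]
  ring

theorem isCkAlong_integral (hR : IsPositiveSqrt Q R) (hμ : IsCenteredGaussian Q μ)
    (hW : ∀ h, IsGaussianLimit R μ (Λ h) (W h)) (hm : Continuous m)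
    (hmι : ∀ x h, m (x + ι h) = m x + R (Λ h)) (φ : X →ᵇ ℝ) (k : ℕ) :
    IsCkAlong ι k (fun x => ∫ y, φ (y + m x) ∂μ) where
  continuous :=
    ((continuousMultilinearCurryFin0 ℝ E ℝ).continuous.comp
      (continuous_iterDerivAlong hR hμ hW hm hmι φ 0)).congr fun x => by
        simp [iterDerivAlong]
  bounded := by
    have := hμ.1
    exact ⟨‖φ‖, fun x => (norm_integral_le_of_norm_le_const (Eventually.of_forall fun y =>
      φ.norm_coe_le_norm _)).trans (by simp)⟩
  differentiable j _ x := by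
    have := hμ.1
    have h1 := ((isIsonormal_of_isGaussianLimit hR hμ hW).analytic_integral_mul_wickExp
      (φ.memLp_comp_add (m x))).1.differentiableAt_iteratedFDeriv
        (WithTop.coe_lt_top (j : ℕ∞))
    rw [← integral_comp_mean_add hR hμ hW hmι] at h1
    rw [DifferentiableAtAlong]
    exact h1.congr_of_eventuallyEq (Eventually.of_forall fun h => iterDerivAlong_add ι _ x j h)
  continuous_deriv j _ := continuous_iterDerivAlong hR hμ hW hm hmι φ j
  bounded_deriv j _ := ⟨_, norm_iterDerivAlong_le hR hμ hW hmι φ j⟩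

end Smoothing

/-! ### The covariance operator and its Gaussian measure -/

theorem toBoundedOperator_apply {V W : Type*} [NormedAddCommGroup V] [NormedSpace ℝ V]
    [NormedAddCommGroup W] [NormedSpace ℝ W] {g : V → W} (hg : IsBoundedLinearMap ℝ g) (v : V) :
    toBoundedOperator g v = g v := by
  rw [toBoundedOperator, dif_pos hg]
  rfl

section Covariance

variable {X Y : Type*} [NormedAddCommGroup X] [InnerProductSpace ℝ X]
  [NormedAddCommGroup Y] [InnerProductSpace ℝ Y]
  {T : ℝ} {U : ℝ → ℝ → X →L[ℝ] X} {B : ℝ → Y →L[ℝ] X} {f : ℝ → X} {s t : ℝ}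

theorem isWhiteNoise_whiteNoise [MeasurableSpace X] {Q : X →L[ℝ] X} {h : X}
    (hex : ∃ g, IsWhiteNoise Q h g) : IsWhiteNoise Q h (whiteNoise Q h) := by
  rw [whiteNoise, dif_pos hex]
  exact hex.choose_spec

theorem ouMean_add {E : Type*} [NormedAddCommGroup E] [NormedSpace ℝ E] (ι : E →L[ℝ] X) (x : X)
    (h : E) : ouMean U f t s (x + ι h) = ouMean U f t s x + U t s (ι h) := by
  simp only [ouMean, map_add]
  abel

variable [CompleteSpace X] [CompleteSpace Y]

theorem hermiteI_eq_hermitePoly [MeasurableSpace X] {E : Type*} [NormedAddCommGroup E]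
    [NormedSpace ℝ E] (ι : E →L[ℝ] X) (n : ℕ) (y : X) (h : Fin n → E) :
    hermiteI ι U B t s n y h = hermitePoly (fun h => whiteNoise (covOp U B t s) (U t s (ι h)) y)
      (fun a b => ⟪ouLambda ι U B t s a, ouLambda ι U B t s b⟫) n h := by
  rw [hermitePoly_eq, hermiteI]
  congr! 4 with m hm
  unfold pairingSum IsPairing
  congr!

variable [TopologicalSpace.SeparableSpace X] [TopologicalSpace.SeparableSpace Y]

theorem OUHypotheses.intervalIntegrable (H : OUHypotheses T U B f) (hs : 0 ≤ s) (hst : s ≤ t)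
    (ht : t ≤ T) (x : X) :
    IntervalIntegrable (fun r => U t r (B r (ContinuousLinearMap.adjoint (B r)
      (ContinuousLinearMap.adjoint (U t r) x)))) volume s t := by
  have hsub : Icc s t ⊆ Icc 0 T := Icc_subset_Icc hs ht
  have hUc : ∀ x, ContinuousOn (fun r => U t r x) (Icc s t) := fun x =>
    (H.evol_continuous x).comp (f := fun r : ℝ => (r, t)) (by fun_prop)
      fun r hr => ⟨hs.trans hr.1, hr.2, ht⟩
  obtain ⟨N, hN⟩ : ∃ N, ∀ r : Icc s t, ‖U t r‖ ≤ N := by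
    refine banach_steinhaus fun x => ?_
    obtain ⟨K, hK⟩ := isCompact_Icc.exists_bound_of_continuousOn (hUc x)
    exact ⟨K, fun r => hK r r.2⟩
  obtain ⟨K, hK⟩ := H.diff_bounded
  have hUm : ∀ x, AEStronglyMeasurable (fun r => U t r x) (volume.restrict (Icc s t)) :=
    fun x => (hUc x).aestronglyMeasurable measurableSet_Icc
  have hBm : ∀ y, AEStronglyMeasurable (fun r => B r y) (volume.restrict (Icc s t)) :=
    fun y => (H.diff_measurable y).mono_measure (Measure.restrict_mono hsub le_rfl)
  rw [intervalIntegrable_iff_integrableOn_Icc_of_le hst]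
  refine Integrable.of_bound (C := N * (K * (K * (N * ‖x‖))))
    (aestronglyMeasurable_apply hUm (aestronglyMeasurable_apply hBm
      (aestronglyMeasurable_apply (fun z => aestronglyMeasurable_adjoint hBm z)
        (aestronglyMeasurable_adjoint hUm x)))) ?_
  refine (ae_restrict_iff' measurableSet_Icc).2 (Eventually.of_forall fun r hr => ?_)
  have h1 : ‖U t r‖ ≤ N := hN ⟨r, hr⟩
  have h2 : ‖B r‖ ≤ K := hK r (hsub hr)
  have hN0 : 0 ≤ N := (norm_nonneg _).trans h1
  have hK0 : 0 ≤ K := (norm_nonneg _).trans h2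
  refine ((U t r).le_of_opNorm_le h1 _).trans (mul_le_mul_of_nonneg_left ?_ hN0)
  refine ((B r).le_of_opNorm_le h2 _).trans (mul_le_mul_of_nonneg_left ?_ hK0)
  refine ((ContinuousLinearMap.adjoint (B r)).le_of_opNorm_le (by simpa using h2) _).trans
    (mul_le_mul_of_nonneg_left ?_ hK0)
  exact (ContinuousLinearMap.adjoint (U t r)).le_of_opNorm_le (by simpa using h1) _

theorem OUHypotheses.inner_covOp (H : OUHypotheses T U B f) (hs : 0 ≤ s) (hst : s ≤ t)
    (ht : t ≤ T) (x y : X) :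
    ⟪covOp U B t s x, y⟫ = ∫ r in s..t,
      ⟪ContinuousLinearMap.adjoint (B r) (ContinuousLinearMap.adjoint (U t r) x),
        ContinuousLinearMap.adjoint (B r) (ContinuousLinearMap.adjoint (U t r) y)⟫ := by
  rw [covOp, toBoundedOperator_apply (isBoundedLinearMap_covFun H hs hst ht), covFun,
    real_inner_comm, ← innerSL_apply_apply ℝ,
    ← ContinuousLinearMap.intervalIntegral_comp_comm _ (H.intervalIntegrable hs hst ht x)]
  refine intervalIntegral.integral_congr fun r _ => ?_
  simp only [innerSL_apply_apply]
  rw [real_inner_comm, ContinuousLinearMap.adjoint_inner_right,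
    ContinuousLinearMap.adjoint_inner_right]

theorem OUHypotheses.isPositive_covOp (H : OUHypotheses T U B f) (hs : 0 ≤ s) (hst : s ≤ t)
    (ht : t ≤ T) : (covOp U B t s).IsPositive := by
  refine (ContinuousLinearMap.isPositive_iff _).2 ⟨fun x y => ?_, fun x => ?_⟩
  · change ⟪covOp U B t s x, y⟫ = ⟪x, covOp U B t s y⟫
    rw [real_inner_comm _ x, H.inner_covOp hs hst ht, H.inner_covOp hs hst ht]
    simp only [real_inner_comm]
  · rw [H.inner_covOp hs hst ht]
    exact intervalIntegral.integral_nonneg hst fun r _ => real_inner_self_nonneg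

/-- A non-negative self-adjoint operator of finite trace is diagonal in some Hilbert basis, which
yields its square root and the Gaussian measure of which it is the covariance. -/
theorem ContinuousLinearMap.IsPositive.exists_diagonal_isPositiveSqrt_isCenteredGaussian
    [MeasurableSpace X] [BorelSpace X] {Q : X →L[ℝ] X} (hQ : Q.IsPositive)
    (htr : HasFiniteTrace Q) :
    (∃ (w : Set X) (e : HilbertBasis w ℝ X) (eig : w → ℝ), ∀ k, Q (e k) = eig k • e k) ∧
      IsPositiveSqrt Q (opSqrt Q) ∧ IsCenteredGaussian Q (centeredGaussian Q) := by
  have : SecondCountableTopology X := UniformSpace.secondCountable_of_separable X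
  obtain ⟨w, e, eig, he⟩ :=
    (hQ.isCompactOperator htr).exists_hilbertBasis_eigenvectors hQ.isSymmetric
  have hR : IsPositiveSqrt Q (opSqrt Q) := by
    have hex := exists_isPositiveSqrt hQ e he
    rw [opSqrt, dif_pos hex]
    exact hex.choose_spec
  have hs : Summable eig := by
    obtain ⟨w', e', h'⟩ := htr
    refine (summable_norm_sq_of_hilbertBasis hR.1.isSymmetric e' e ?_).congr fun k => ?_
    · simpa only [hR.norm_apply_sq] using h'
    · rw [hR.norm_apply_sq, he, real_inner_smul_left, real_inner_self_eq_norm_sq,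
        e.orthonormal.1 k]
      simp
  have := countable_hilbertBasis e
  have hex := exists_isCenteredGaussian hQ e he hs
  refine ⟨⟨w, e, eig, he⟩, hR, ?_⟩
  rw [centeredGaussian, dif_pos hex]
  exact hex.choose_spec

end Covariance

/-! ### Derivatives of the Ornstein–Uhlenbeck evolution operator -/

theorem mainTheorem3 :
    ∃ C : ℕ → ℝ, (∀ n, 0 < C n) ∧
    ∀ (X : Type*) [NormedAddCommGroup X] [InnerProductSpace ℝ X] [CompleteSpace X]
      [TopologicalSpace.SeparableSpace X] [MeasurableSpace X] [BorelSpace X]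
      (Y : Type*) [NormedAddCommGroup Y] [InnerProductSpace ℝ Y] [CompleteSpace Y]
      [TopologicalSpace.SeparableSpace Y]
      (E : Type*) [NormedAddCommGroup E] [NormedSpace ℝ E]
      (ι : E →L[ℝ] X) (_ : Function.Injective ι)
      (T : ℝ) (U : ℝ → ℝ → X →L[ℝ] X) (B : ℝ → Y →L[ℝ] X) (f : ℝ → X)
      (_ : OUHypotheses T U B f)
      (s t : ℝ) (_ : 0 ≤ s) (_ : s < t) (_ : t ≤ T)
      (_ : MapsToCameronMartin ι (U t s) (covOp U B t s)),
    -- the objects exist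
    (IsCenteredGaussian (covOp U B t s) (centeredGaussian (covOp U B t s)) ∧
      IsPositiveSqrt (covOp U B t s) (opSqrt (covOp U B t s)) ∧
      ∀ h : E, IsWhiteNoise (covOp U B t s) (U t s (ι h))
        (whiteNoise (covOp U B t s) (U t s (ι h)))) ∧
    ∀ φ : X →ᵇ ℝ,
      -- regularity along `E`
      (∀ k : ℕ, IsCkAlong ι k (ouEvolution U B f s t φ)) ∧
      -- the first derivative
      (∀ (x : X) (h : E),
        Integrable (fun y => φ (y + ouMean U f t s x) *
            whiteNoise (covOp U B t s) (U t s (ι h)) y)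
          (centeredGaussian (covOp U B t s)) ∧
        derivAlong ι (ouEvolution U B f s t φ) x h =
          ∫ y, φ (y + ouMean U f t s x) * whiteNoise (covOp U B t s) (U t s (ι h)) y
            ∂(centeredGaussian (covOp U B t s))) ∧
      (∀ x : X, ‖derivAlong ι (ouEvolution U B f s t φ) x‖ ≤
        C 1 * ‖ouLambda ι U B t s‖ * ‖φ‖) ∧
      -- the higher derivatives
      (∀ n : ℕ, 2 ≤ n → ∀ (x : X) (h : Fin n → E),
        Integrable (fun y => φ (y + ouMean U f t s x) * hermiteI ι U B t s n y h)
          (centeredGaussian (covOp U B t s)) ∧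
        iterDerivAlong ι (ouEvolution U B f s t φ) n x h =
          ∫ y, φ (y + ouMean U f t s x) * hermiteI ι U B t s n y h
            ∂(centeredGaussian (covOp U B t s))) ∧
      (∀ n : ℕ, 2 ≤ n → ∀ x : X,
        ‖iterDerivAlong ι (ouEvolution U B f s t φ) n x‖ ≤
          C n * ‖ouLambda ι U B t s‖ ^ n * ‖φ‖) := by

  refine ⟨hermiteConst, hermiteConst_pos, ?_⟩
  intro X _ _ _ _ _ _ Y _ _ _ _ E _ _ ι _ T U B f H s t hs hst ht hCM
  have : SecondCountableTopology X := UniformSpace.secondCountable_of_separable X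
  have hQ := H.isPositive_covOp hs hst.le ht
  obtain ⟨⟨w, e, eig, he⟩, hR, hμ⟩ :=
    hQ.exists_diagonal_isPositiveSqrt_isCenteredGaussian (H.finite_trace s t hs hst ht)
  have hΛ : ∀ h, ouLambda ι U B t s h ∈
      (LinearMap.ker (opSqrt (covOp U B t s) : X →ₗ[ℝ] X))ᗮ ∧
      opSqrt (covOp U B t s) (ouLambda ι U B t s h) = U t s (ι h) := fun h => by
    rw [ouLambda, toBoundedOperator_apply hCM.isBoundedLinearMap]
    exact pseudoInverse_spec _ (hCM.1 h)
  have hwn : ∀ h, IsWhiteNoise (covOp U B t s) (U t s (ι h))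
      (whiteNoise (covOp U B t s) (U t s (ι h))) := fun h => by
    rw [← (hΛ h).2]
    exact isWhiteNoise_whiteNoise (exists_isWhiteNoise hR hQ hμ e he (hΛ h).1)
  refine ⟨⟨hμ, hR, hwn⟩, fun φ => ?_⟩
  have hW : ∀ h, IsGaussianLimit (opSqrt (covOp U B t s)) (centeredGaussian (covOp U B t s))
      (ouLambda ι U B t s h) (whiteNoise (covOp U B t s) (U t s (ι h))) := fun h =>
    IsWhiteNoise.isGaussianLimit hR hQ (hΛ h).1 (by rw [(hΛ h).2]; exact hwn h)
  have hm : Continuous (ouMean U f t s) := by unfold ouMean; fun_prop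
  have hmι : ∀ x h, ouMean U f t s (x + ι h) =
      ouMean U f t s x + opSqrt (covOp U B t s) (ouLambda ι U B t s h) := fun x h => by
    rw [(hΛ h).2, ouMean_add]
  have hP : ouEvolution U B f s t φ =
    fun x => ∫ y, φ (y + ouMean U f t s x) ∂(centeredGaussian (covOp U B t s)) := rfl
  rw [hP]
  refine ⟨isCkAlong_integral hR hμ hW hm hmι φ, fun x h => ?_, fun x => ?_, fun n _ x h => ?_,
    fun n _ x => norm_iterDerivAlong_le hR hμ hW hmι φ n x⟩
  · have h1 := integrable_and_iterDerivAlong_eq hR hμ hW hmι φ 1 x fun _ => h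
    simpa only [iterDerivAlong_one_apply, hermitePoly] using h1
  · have h1 := norm_iterDerivAlong_le hR hμ hW hmι φ 1 x
    rw [pow_one] at h1
    exact (norm_derivAlong_le ι _ x).trans h1
  · simp only [hermiteI_eq_hermitePoly]
    exact integrable_and_iterDerivAlong_eq hR hμ hW hmι φ n x h
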